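/- Let $n,m\ge 1$ and $1\le i\le n$. **Crystals.** Operators $e_\ell,f_\ell$ ($0\le \ell\le n$) take values in the underlying set together with $0$ (and $0\mapsto 0$). $B^{i,m}$ is the set of arrays $A=(a_{p,q})$ of non-negative integers with columns $1\le p\le i$ and rows $i\le q\le n$ (put $a_{p,q}=0$ elsewhere) whose sum along every Dyck path from $(1,i)$ to $(i,n)$ (steps $(p,q)\to(p,q+1)$ or $(p+1,q)$) is at most $m$. For $A\in B^{i,m}$, let $p_+^\ell$ and $q_+^\ell$ be the smallest and the largest $p\in[1,i]$ maximizing $\sum_{j\le p}a_{j,\ell-1}+\sum_{j\ge p}a_{j,\ell}$, and let $q_-^\ell$ and $p_-^\ell$ be the smallest and the largest $p\in[i,n]$ maximizing $\sum_{j\le p}a_{\ell,j}+\sum_{j\ge p}a_{\ell+1,j}$. Put $$\varphi_\ell(A)=\begin{cases}a_{1,n}&\ell=0\\ m-\sum_{j<i}a_{j,i}-\sum_{j=i}^n a_{i,j}&\ell=i\\ \sum_{j\le p_+^\ell}a_{j,\ell-1}-\sum_{j<p_+^\ell}a_{j,\ell}&\ell>i\\ \sum_{j\ge p_-^\ell}a_{\ell+1,j}-\sum_{j>p_-^\ell}a_{\ell,j}&0<\ell<i\end{cases}$$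 $$\epsilon_\ell(A)=\begin{cases}m-\sum_{j=i}^n a_{1,j}-\sum_{j=2}^i a_{j,n}&\ell=0\\ a_{i,i}&\ell=i\\ \sum_{j\ge q_+^\ell}a_{j,\ell}-\sum_{j>q_+^\ell}a_{j,\ell-1}&\ell>i\\ \sum_{j\le q_-^\ell}a_{\ell,j}-\sum_{j<q_-^\ell}a_{\ell+1,j}&0<\ell<i.\end{cases}$$ If $\varphi_\ell(A)=0$, then $f_\ell(A)=0$; otherwise $f_0$ lowers $a_{1,n}$ by $1$, $f_i$ raises $a_{i,i}$ by $1$, $f_\ell$ ($\ell>i$) moves $1$ from $a_{p_+^\ell,\ell-1}$ to $a_{p_+^\ell,\ell}$, and $f_\ell$ ($0<\ell<i$) moves $1$ from $a_{\ell+1,p_-^\ell}$ to $a_{\ell,p_-^\ell}$. If $\epsilon_\ell(A)=0$, then $e_\ell(A)=0$; otherwise $e_0$ raises $a_{1,n}$ by $1$, $e_i$ lowers $a_{i,i}$ by $1$, $e_\ell$ ($\ell>i$) moves $1$ from $a_{q_+^\ell,\ell}$ to $a_{q_+^\ell,\ell-1}$, and $e_\ell$ ($0<\ell<i$) moves $1$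 from $a_{\ell,q_-^\ell}$ to $a_{\ell+1,q_-^\ell}$. $\mathrm{SSYT}(m\omega_i)$ is the set of semistandard tableaux with $i$ rows of length $m$ and entries in $\{1,\dots,n+1\}$. For $1\le j\le n$, $f_j$ and $e_j$ are given by the signature rule: read the rows from left to right, starting with the bottom row; pair each $j+1$ with a $j$ to its right (bracketing); $f_j$ changes the rightmost unpaired $j$ into $j+1$, $e_j$ changes the leftmost unpaired $j+1$ into $j$, and the result is $0$ if there is none. Moreover $f_0=\mathrm{pr}^{-1}f_1\,\mathrm{pr}$ and $e_0=\mathrm{pr}^{-1}e_1\,\mathrm{pr}$ with Schützenberger's promotion $\mathrm{pr}$. Here $\varphi_j(T)=\max\{k\ge0: f_j^k(T)\ne0\}$ and $\epsilon_j(T)=\max\{k\ge 0:e_j^k(T)\ne0\}$. Let $T^{(0)}$ be the tableau whose $j$-th row consists of $j$'s. **Inductive operators.** Products of operators $\prod_{j=s}^{t}g_j=g_sg_{s+1}\cdots g_t$ are compositions in which $g_t$ acts first (the identity if $s>t$). The operator $f_j^{\varphi_j-a}$ maps $x$ to $f_j^{\varphi_j(x)-a}(x)$, undefined if $a>\varphi_j(x)$;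 similarly for $e_j^{\epsilon_j-a}$. For $A\in B^{i,m}$, let $A^{(k)}$ be obtained from $A$ by setting all rows with index $<k$ to zero. For a non-zero $Q=(q_{s,t})\in B^{i,m}$ and $i\le k\le n$, let $t=t^Q$ be the least column index of a non-zero entry in the first non-zero row of $Q$, and put $$\mathcal K^{Q}_k=\Bigl(\prod_{j=i+1}^{k}f_{k+i+1-j}^{\varphi_{k+i+1-j}}\Bigr)\Bigl(\prod_{j=t+1}^{i}e_{i+t+1-j}^{\epsilon_{i+t+1-j}-q_{i+t+1-j,k}}\Bigr)\Bigl(f_t^{q_{t,k}}\prod_{j=t+1}^{i}f_j^{\varphi_j}\Bigr);$$ let $\mathcal K^{0}_k$ be the identity. **Claim.** Let $\varphi_{i,m}:B^{i,m}\to\mathrm{SSYT}(m\omega_i)$ be the affine crystal isomorphism, that is, a bijection commuting with all $e_\ell,f_\ell$, $0\le\ell\le n$. Let $A\in B^{i,m}$ and let $r$ be the index of its first non-zero row ($r=n+1$ if $A=0$). Then $$\varphi_{i,m}(A)=\mathcal K^{A^{(r)}}_{r}\,\mathcal K^{A^{(r+1)}}_{r+1}\cdots\mathcal K^{A^{(n)}}_{n}\,(T^{(0)}),$$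 where in particular all the operators are defined and non-zero on the tableaux to which they are applied. The same holds if the factors for those $k$ for which row $k$ of $A$ is zero are omitted; for each remaining $k$, it is the first non-zero row of $A^{(k)}$. -/

import Mathlib

namespace KR

/-! ### Crystals: partial operators, their powers and products -/

/-- The data of a crystal with underlying set `carrier` and with nodes numbered `0, 1, …, n`.
The operators have values in `Option X`, where `none` stands for the extra element `0`
(and also for an undefined expression). -/
structure Crystal (X : Type) where
  carrier : Set X
  e : ℕ → X → Option X
  f : ℕ → X → Option X
  eps : ℕ → X → ℕ
  phi : ℕ → X → ℕ

/-- The power `g ^ k` of a partial operator. -/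
def opPow {X : Type} (g : X → Option X) (k : ℕ) (x : X) : Option X :=
  (fun o : Option X => o.bind g)^[k] (some x)

/-- The product `g s * g (s + 1) * ⋯ * g t`, in which `g t` acts first;
it is the identity if `s > t`. -/
def opProd {X : Type} (s t : ℕ) (g : ℕ → X → Option X) (x : X) : Option X :=
  (List.range' s (t + 1 - s)).foldr (fun j y => y.bind (g j)) (some x)

/-- `max {k | g ^ k x ≠ 0}`. -/
noncomputable def stringLength {X : Type} (g : X → Option X) (x : X) : ℕ :=
  sSup {k : ℕ | opPow g k x ≠ none}

/-- `f_j ^ (φ_j - a)`, that is `x ↦ f_j ^ (φ_j(x) - a) (x)`, undefined if `a > φ_j(x)`. -/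
def Crystal.fTop {X : Type} (C : Crystal X) (j a : ℕ) (x : X) : Option X :=
  if a ≤ C.phi j x then opPow (C.f j) (C.phi j x - a) x else none

/-- `e_j ^ (ε_j - a)`, that is `x ↦ e_j ^ (ε_j(x) - a) (x)`, undefined if `a > ε_j(x)`. -/
def Crystal.eTop {X : Type} (C : Crystal X) (j a : ℕ) (x : X) : Option X :=
  if a ≤ C.eps j x then opPow (C.e j) (C.eps j x - a) x else none

/-- `Φ` is an isomorphism of crystals with nodes `0, …, n`: a bijection of the underlying sets
which commutes with all raising and lowering operators. (For seminormal crystals `Φ` then also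
preserves `ε` and `φ`, which are the lengths of strings, and the classical weight, which is given
by its values `φ_ℓ - ε_ℓ` on the simple coroots.) -/
structure IsCrystalIso {X Y : Type} (n : ℕ) (C : Crystal X) (D : Crystal Y) (Φ : X → Y) :
    Prop where
  bijOn : Set.BijOn Φ C.carrier D.carrier
  map_e : ∀ ℓ ≤ n, ∀ x ∈ C.carrier, D.e ℓ (Φ x) = (C.e ℓ x).map Φ
  map_f : ∀ ℓ ≤ n, ∀ x ∈ C.carrier, D.f ℓ (Φ x) = (C.f ℓ x).map Φ

/-! ### The polytope realization -/

/-- A pattern; `A p q` is the entry `a_{p,q}` in column `p` and row `q`. -/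
abbrev Pattern := ℕ → ℕ → ℕ

/-- `β(1), …, β(n)` is a Dyck path from `(1,i)` to `(i,n)`. -/
def IsDyckPath (n i : ℕ) (β : ℕ → ℕ × ℕ) : Prop :=
  β 1 = (1, i) ∧ β n = (i, n) ∧
    ∀ r, 1 ≤ r → r < n →
      β (r + 1) = ((β r).1, (β r).2 + 1) ∨ β (r + 1) = ((β r).1 + 1, (β r).2)

/-- The set `B^{i,m}`; entries outside columns `1, …, i` and rows `i, …, n` are zero. -/
def polytope (n i m : ℕ) : Set Pattern :=
  {A | (∀ p q, ¬ (1 ≤ p ∧ p ≤ i ∧ i ≤ q ∧ q ≤ n) → A p q = 0) ∧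
    ∀ β : ℕ → ℕ × ℕ, IsDyckPath n i β →
      ∑ r ∈ Finset.Icc 1 n, A (β r).1 (β r).2 ≤ m}

/-- Points of `[a, b]` at which `v` takes its maximal value on `[a, b]`. -/
def argmaxSet (a b : ℕ) (v : ℕ → ℕ) : Finset ℕ :=
  (Finset.Icc a b).filter (fun p => ∀ q ∈ Finset.Icc a b, v q ≤ v p)

/-- The smallest element (`d` for the empty set). -/
def minOr (d : ℕ) (S : Finset ℕ) : ℕ := S.min.untopD d

/-- The largest element (`d` for the empty set). -/
def maxOr (d : ℕ) (S : Finset ℕ) : ℕ := S.max.unbotD d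

/-- For `ℓ > i`: `a_{1,ℓ-1} + ⋯ + a_{p,ℓ-1} + a_{p,ℓ} + ⋯ + a_{i,ℓ}`. -/
def rowPathSum (i ℓ : ℕ) (A : Pattern) (p : ℕ) : ℕ :=
  ∑ j ∈ Finset.Icc 1 p, A j (ℓ - 1) + ∑ j ∈ Finset.Icc p i, A j ℓ

/-- For `ℓ < i`: `a_{ℓ,i} + ⋯ + a_{ℓ,p} + a_{ℓ+1,p} + ⋯ + a_{ℓ+1,n}`. -/
def colPathSum (n i ℓ : ℕ) (A : Pattern) (p : ℕ) : ℕ :=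
  ∑ j ∈ Finset.Icc i p, A ℓ j + ∑ j ∈ Finset.Icc p n, A (ℓ + 1) j

/-- `p_+^ℓ(A)`. -/
def pPlus (i ℓ : ℕ) (A : Pattern) : ℕ := minOr 0 (argmaxSet 1 i (rowPathSum i ℓ A))

/-- `q_+^ℓ(A)`. -/
def qPlus (i ℓ : ℕ) (A : Pattern) : ℕ := maxOr 0 (argmaxSet 1 i (rowPathSum i ℓ A))

/-- `p_-^ℓ(A)`. -/
def pMinus (n i ℓ : ℕ) (A : Pattern) : ℕ := maxOr 0 (argmaxSet i n (colPathSum n i ℓ A))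

/-- `q_-^ℓ(A)`. -/
def qMinus (n i ℓ : ℕ) (A : Pattern) : ℕ := minOr 0 (argmaxSet i n (colPathSum n i ℓ A))

/-- `φ_ℓ` on `B^{i,m}`; the subtractions never truncate on `B^{i,m}`. -/
def polyPhi (n i m ℓ : ℕ) (A : Pattern) : ℕ :=
  if ℓ = 0 then A 1 n
  else if ℓ = i then m - ∑ j ∈ Finset.Icc 1 (i - 1), A j i - ∑ j ∈ Finset.Icc i n, A i j
  else if i < ℓ then
    ∑ j ∈ Finset.Icc 1 (pPlus i ℓ A), A j (ℓ - 1)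
      - ∑ j ∈ Finset.Icc 1 (pPlus i ℓ A - 1), A j ℓ
  else
    ∑ j ∈ Finset.Icc (pMinus n i ℓ A) n, A (ℓ + 1) j
      - ∑ j ∈ Finset.Icc (pMinus n i ℓ A + 1) n, A ℓ j

/-- `ε_ℓ` on `B^{i,m}`; the subtractions never truncate on `B^{i,m}`. -/
def polyEps (n i m ℓ : ℕ) (A : Pattern) : ℕ :=
  if ℓ = 0 then m - ∑ j ∈ Finset.Icc i n, A 1 j - ∑ j ∈ Finset.Icc 2 i, A j n
  else if ℓ = i then A i i
  else if i < ℓ then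
    ∑ j ∈ Finset.Icc (qPlus i ℓ A) i, A j ℓ
      - ∑ j ∈ Finset.Icc (qPlus i ℓ A + 1) i, A j (ℓ - 1)
  else
    ∑ j ∈ Finset.Icc i (qMinus n i ℓ A), A ℓ j
      - ∑ j ∈ Finset.Icc i (qMinus n i ℓ A - 1), A (ℓ + 1) j

/-- Replace the entry in position `(p, q)` by `v`. -/
def setEntry (A : ℕ → ℕ → ℕ) (p q v : ℕ) : ℕ → ℕ → ℕ :=
  fun p' q' => if p' = p ∧ q' = q then v else A p' q'

/-- Add `1` to the entry in position `(p, q)`. -/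
def inc (A : Pattern) (p q : ℕ) : Pattern := setEntry A p q (A p q + 1)

/-- Subtract `1` from the entry in position `(p, q)`. -/
def dec (A : Pattern) (p q : ℕ) : Pattern := setEntry A p q (A p q - 1)

/-- The lowering operators `f_0, …, f_n` on `B^{i,m}`. -/
def polyF (n i m ℓ : ℕ) (A : Pattern) : Option Pattern :=
  if polyPhi n i m ℓ A = 0 then none
  else if ℓ = 0 then some (dec A 1 n)
  else if ℓ = i then some (inc A i i)
  else if i < ℓ then some (inc (dec A (pPlus i ℓ A) (ℓ - 1)) (pPlus i ℓ A) ℓ)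
  else some (dec (inc A ℓ (pMinus n i ℓ A)) (ℓ + 1) (pMinus n i ℓ A))

/-- The raising operators `e_0, …, e_n` on `B^{i,m}`. -/
def polyE (n i m ℓ : ℕ) (A : Pattern) : Option Pattern :=
  if polyEps n i m ℓ A = 0 then none
  else if ℓ = 0 then some (inc A 1 n)
  else if ℓ = i then some (dec A i i)
  else if i < ℓ then some (dec (inc A (qPlus i ℓ A) (ℓ - 1)) (qPlus i ℓ A) ℓ)
  else some (inc (dec A ℓ (qMinus n i ℓ A)) (ℓ + 1) (qMinus n i ℓ A))

/-- The polytope realization `B^{i,m}` of the Kirillov–Reshetikhin crystal of type `A_n^{(1)}`. -/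
def polytopeCrystal (n i m : ℕ) : Crystal Pattern where
  carrier := polytope n i m
  e := polyE n i m
  f := polyF n i m
  eps := polyEps n i m
  phi := polyPhi n i m

/-! ### The tableau realization -/

/-- A filling; `T r c` is the entry of the box in row `r` and column `c`, both counted
from `0`. Entries outside the rectangle of `i` rows and `m` columns are zero. -/
abbrev Filling := ℕ → ℕ → ℕ

/-- The Young diagram with `i` rows of length `m`. -/
def rect (i m : ℕ) : YoungDiagram where
  cells := Finset.range i ×ˢ Finset.range m
  isLowerSet := by
    intro a b hab ha
    simp only [Finset.coe_product, Finset.coe_range, Set.mem_prod, Set.mem_Iio] at ha ⊢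
    exact ⟨lt_of_le_of_lt hab.1 ha.1, lt_of_le_of_lt hab.2 ha.2⟩

/-- `SSYT(m ω_i)`: semistandard tableaux of shape `(m^i)` with entries in `{1, …, n + 1}`. -/
def ssyt (n i m : ℕ) : Set Filling :=
  {T | (∃ S : SemistandardYoungTableau (rect i m), ∀ r c, S r c = T r c) ∧
    ∀ r < i, ∀ c < m, 1 ≤ T r c ∧ T r c ≤ n + 1}

/-- The boxes in reading order: along rows from left to right, from the bottom row upwards. -/
def readingOrder (i m : ℕ) : List (ℕ × ℕ) :=
  (List.range i).reverse.flatMap (fun r => (List.range m).map (fun c => (r, c)))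

/-- One step of the bracketing for the letters `j` and `j + 1`. The state consists of the
unpaired boxes `j` met so far and of the boxes `j + 1` met so far and not yet paired, both with
the most recent box first. A letter `j` is paired with the nearest unpaired `j + 1` to its left. -/
def bracketStep (T : Filling) (j : ℕ) (s : List (ℕ × ℕ) × List (ℕ × ℕ)) (b : ℕ × ℕ) :
    List (ℕ × ℕ) × List (ℕ × ℕ) :=
  if T b.1 b.2 = j + 1 then (s.1, b :: s.2)
  else if T b.1 b.2 = j then
    match s.2 with
    | [] => (b :: s.1, [])
    | _ :: rest => (s.1, rest)
  else s

/-- The unpaired boxes `j` and the unpaired boxes `j + 1`, each from right to left in the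
reading word. -/
def unpaired (i m : ℕ) (T : Filling) (j : ℕ) : List (ℕ × ℕ) × List (ℕ × ℕ) :=
  (readingOrder i m).foldl (bracketStep T j) ([], [])

/-- `f_j` for `1 ≤ j ≤ n`: the rightmost unpaired `j` becomes `j + 1`. -/
def sigF (i m j : ℕ) (T : Filling) : Option Filling :=
  (unpaired i m T j).1.head?.map (fun b => setEntry T b.1 b.2 (j + 1))

/-- `e_j` for `1 ≤ j ≤ n`: the leftmost unpaired `j + 1` becomes `j`. -/
def sigE (i m j : ℕ) (T : Filling) : Option Filling :=
  (unpaired i m T j).2.getLast?.map (fun b => setEntry T b.1 b.2 j)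

/-- The jeu-de-taquin slide which moves an empty box from `(r, c)` to the corner `(0, 0)`,
where it is filled with `0`: the larger one of the neighbours above and to the left moves into
the empty box, the one above if they are equal. -/
def slideIn (T : Filling) : ℕ → ℕ → Filling
  | 0, 0 => setEntry T 0 0 0
  | r + 1, 0 => slideIn (setEntry T (r + 1) 0 (T r 0)) r 0
  | 0, c + 1 => slideIn (setEntry T 0 (c + 1) (T 0 c)) 0 c
  | r + 1, c + 1 =>
    if T (r + 1) c ≤ T r (c + 1) then
      slideIn (setEntry T (r + 1) (c + 1) (T r (c + 1))) r (c + 1)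
    else
      slideIn (setEntry T (r + 1) (c + 1) (T (r + 1) c)) (r + 1) c
termination_by r c => r + c

/-- The jeu-de-taquin slide which moves an empty box from `(r, c)` to the corner
`(i - 1, m - 1)`, where it is filled with `v`: the smaller one of the neighbours below and to the
right moves into the empty box, the one below if they are equal. -/
def slideOut (i m v : ℕ) (T : Filling) (r c : ℕ) : Filling :=
  if r + 1 < i then
    if c + 1 < m then
      if T (r + 1) c ≤ T r (c + 1) then
        slideOut i m v (setEntry T r c (T (r + 1) c)) (r + 1) c
      else
        slideOut i m v (setEntry T r c (T r (c + 1))) r (c + 1)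
    else slideOut i m v (setEntry T r c (T (r + 1) c)) (r + 1) c
  else if c + 1 < m then slideOut i m v (setEntry T r c (T r (c + 1))) r (c + 1)
  else setEntry T r c v
termination_by (i - r) + (m - c)

/-- Schützenberger's promotion: the boxes with entry `n + 1` (all in the last row) are emptied
and slid, from left to right, to the top left corner and filled with `0`; then all entries are
increased by `1`. -/
def promotion (n i m : ℕ) (T : Filling) : Filling :=
  let S := (List.range m).foldl
    (fun S c => if S (i - 1) c = n + 1 then slideIn S (i - 1) c else S) T
  fun r c => if r < i ∧ c < m then S r c + 1 else 0

/-- Inverse promotion: the boxes with entry `1` (all in the first row) are emptied and slid, from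
right to left, to the bottom right corner and filled with `n + 2`; then all entries are decreased
by `1`. -/
def invPromotion (n i m : ℕ) (T : Filling) : Filling :=
  let S := (List.range m).reverse.foldl
    (fun S c => if S 0 c = 1 then slideOut i m (n + 2) S 0 c else S) T
  fun r c => if r < i ∧ c < m then S r c - 1 else 0

/-- The lowering operators `f_0, …, f_n` on tableaux, `f_0 = pr⁻¹ ∘ f_1 ∘ pr`. -/
def tabF (n i m ℓ : ℕ) (T : Filling) : Option Filling :=
  if ℓ = 0 then (sigF i m 1 (promotion n i m T)).map (invPromotion n i m) else sigF i m ℓ T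

/-- The raising operators `e_0, …, e_n` on tableaux, `e_0 = pr⁻¹ ∘ e_1 ∘ pr`. -/
def tabE (n i m ℓ : ℕ) (T : Filling) : Option Filling :=
  if ℓ = 0 then (sigE i m 1 (promotion n i m T)).map (invPromotion n i m) else sigE i m ℓ T

/-- The tableau realization `SSYT(m ω_i)` of the Kirillov–Reshetikhin crystal of type
`A_n^{(1)}`. -/
noncomputable def tableauCrystal (n i m : ℕ) : Crystal Filling where
  carrier := ssyt n i m
  e := tabE n i m
  f := tabF n i m
  eps := fun ℓ T => stringLength (tabE n i m ℓ) T
  phi := fun ℓ T => stringLength (tabF n i m ℓ) T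

/-- The highest weight tableau: all entries of the `j`-th row are equal to `j`. -/
def highestTableau (i m : ℕ) : Filling :=
  fun r c => if r < i ∧ c < m then r + 1 else 0

/-! ### The inductive operators -/

/-- The column indices of the non-zero entries in row `k` of `Q`. -/
def rowSupport (i : ℕ) (Q : Pattern) (k : ℕ) : Finset ℕ :=
  (Finset.Icc 1 i).filter (fun p => Q p k ≠ 0)

/-- The index of the first non-zero row of `Q`; it is `n + 1` if `Q = 0`. -/
def firstRow (n i : ℕ) (Q : Pattern) : ℕ :=
  minOr (n + 1) ((Finset.Icc i n).filter (fun k => rowSupport i Q k ≠ ∅))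

/-- The least column index of a non-zero entry in the first non-zero row of `Q ≠ 0`. -/
def firstCol (n i : ℕ) (Q : Pattern) : ℕ := minOr 0 (rowSupport i Q (firstRow n i Q))

/-- `A^{(k)}`: all rows of `A` with index `< k` are replaced by zero. -/
def truncRows (A : Pattern) (k : ℕ) : Pattern := fun p q => if q < k then 0 else A p q

/-- `F = f_t ^ {q_{t,k}} ∏_{j=t+1}^i f_j ^ {φ_j}`. -/
def opF {X : Type} (C : Crystal X) (i k t : ℕ) (Q : Pattern) (x : X) : Option X :=
  (opProd (t + 1) i (fun j => C.fTop j 0) x).bind (opPow (C.f t) (Q t k))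

/-- `E = ∏_{j=t+1}^i e_{i+t+1-j} ^ {ε_{i+t+1-j} - q_{i+t+1-j,k}}`. -/
def opE {X : Type} (C : Crystal X) (i k t : ℕ) (Q : Pattern) : X → Option X :=
  opProd (t + 1) i (fun j => C.eTop (i + t + 1 - j) (Q (i + t + 1 - j) k))

/-- `H = ∏_{j=i+1}^k f_{k+i+1-j} ^ {φ_{k+i+1-j}}`. -/
def opH {X : Type} (C : Crystal X) (i k : ℕ) : X → Option X :=
  opProd (i + 1) k (fun j => C.fTop (k + i + 1 - j) 0)

/-- The operator `H E F` for a non-zero pattern `Q` and a row index `k`, with `t` the least column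
index of a non-zero entry in the first non-zero row of `Q`; it is the identity if `Q = 0`. -/
def opK {X : Type} (C : Crystal X) (n i : ℕ) (Q : Pattern) (k : ℕ) (x : X) : Option X :=
  if n < firstRow n i Q then some x
  else ((opF C i k (firstCol n i Q) Q x).bind (opE C i k (firstCol n i Q) Q)).bind (opH C i k)

end KR

/-!
The bijection `Φ` commutes with all operators, and on a crystal whose strings have the lengths
prescribed by `ε` and `φ` this determines how every `f_j^{φ_j - a}` and `e_j^{ε_j - a}` acts on the
image of `Φ`. So everything can be computed with patterns. The pattern `0` is killed by
`e_1, …, e_n`, hence `Φ 0` is the highest weight tableau (`map_zero_eq_highestTableau`), and it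
remains to see that the operator `𝒦_k` maps the pattern `A^{(k+1)}` to `A^{(k)}`
(`opK_truncRows`), for every `k` whether row `k` is zero or not. Only the nodes `1, …, n` occur, so
promotion plays no role.

*The polytope crystal is seminormal* (`polytopeCrystal_isSeminormalAt`). For `ℓ < i` the operators
act on two adjacent columns `u, w`. Let `M` be the greatest sum along a path through `u` and then
`w`. Then `φ_ℓ = M - ∑ u` and `ε_ℓ = M - ∑ w`; `f_ℓ` moves a unit from `w` to `u` at the last
maximizing row and preserves `M`, so that this row becomes the first maximizing one and `e_ℓ`
undoes the step. For `ℓ > i` the same holds for two adjacent rows, with `e` and `f` exchanged.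
The polytope is preserved: this is checked on potentials, which certify the bounds
on all Dyck paths simultaneously (`mem_polytope_iff`, `HasPotential.moveLeft`,
`HasPotential.moveRight`, `HasPotential.inc_corner`).

*Maximal strings.* The operator `f_ℓ` also preserves the greatest path sums over all final
segments of the two columns. At the end of an `f_ℓ`-string these are sums of column `ℓ`
alone, so the end of the string is determined by the path sums at its beginning
(`fTop_zero_spec_of_lt`).

*The operator `𝒦_k = H E F`.* Let `x = A^{(k+1)}`, let `q` be row `k` of `A`, and let `x'` be `x`
with `q` placed in row `i`. As the rows below `k` are empty, `H` moves `q` from row `i` to row `k`,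
that is `H x' = A^{(k)}` (`fTop_shiftedRow`); this also shows that `x'` lies in the polytope. Now
apply the maximal powers of `f_i, f_{i-1}, …` to both `x` and `x'`. The two runs
stay close to each other (`RunInvariant`): above row `i` they agree in all columns reached, every
column just filled is saturated, having the greatest sum that the path bound `m` admits, and in
row `i` they differ by partial sums of `q`. It follows that
`ε_s = q_s` holds on the second run before `f_s` is applied, so that
`e_{t+1}^{ε - q_{t+1}}, …, e_i^{ε - q_i}` lead back along it to `x'`; and since `q` vanishes to the
left of column `t`, the two states before the application of `f_t` differ exactly by
`f_t^{q_t}` (`exists_runs`). So `E F x = x'`.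
-/

namespace KR

/-! ### Strings of partial operators -/

section Strings

variable {X Y : Type}

theorem opPow_succ_last (g : X → Option X) (k : ℕ) (x : X) :
    opPow g (k + 1) x = (opPow g k x).bind g := by
  simp only [opPow, Function.iterate_succ_apply']

theorem opPow_succ_of_eq {g : X → Option X} {x y : X} (h : g x = some y) (k : ℕ) :
    opPow g (k + 1) x = opPow g k y := by
  simp only [opPow, Function.iterate_succ_apply, Option.bind_some, h]

/-- On `S` the operator `g` lowers `len` by one, and vanishes exactly where `len` does. -/
structure IsStringOp (S : Set X) (g : X → Option X) (len : X → ℕ) : Prop where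
  none_iff : ∀ x ∈ S, g x = none ↔ len x = 0
  mem : ∀ x ∈ S, ∀ y, g x = some y → y ∈ S
  len_eq : ∀ x ∈ S, ∀ y, g x = some y → len x = len y + 1

namespace IsStringOp

variable {S : Set X} {g : X → Option X} {len : X → ℕ}

theorem opPow_spec (h : IsStringOp S g len) {x y : X} (hx : x ∈ S) {k : ℕ}
    (hk : opPow g k x = some y) : y ∈ S ∧ len x = len y + k := by
  induction k generalizing y with
  | zero => cases hk; exact ⟨hx, rfl⟩
  | succ k ih =>
    rw [opPow_succ_last, Option.bind_eq_some_iff] at hk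
    obtain ⟨z, hz, hzy⟩ := hk
    obtain ⟨hzS, hl⟩ := ih hz
    have := h.len_eq z hzS y hzy
    exact ⟨h.mem z hzS y hzy, by omega⟩

theorem exists_opPow (h : IsStringOp S g len) {x : X} (hx : x ∈ S) {k : ℕ} (hk : k ≤ len x) :
    ∃ y, opPow g k x = some y := by
  induction k with
  | zero => exact ⟨x, rfl⟩
  | succ k ih =>
    obtain ⟨y, hy⟩ := ih (by omega)
    obtain ⟨hyS, hl⟩ := h.opPow_spec hx hy
    have hne : g y ≠ none := by
      rw [Ne, h.none_iff y hyS]; omega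
    obtain ⟨z, hz⟩ := Option.ne_none_iff_exists'.mp hne
    exact ⟨z, by rw [opPow_succ_last, hy]; exact hz⟩

theorem opPow_ne_none_iff (h : IsStringOp S g len) {x : X} (hx : x ∈ S) {k : ℕ} :
    opPow g k x ≠ none ↔ k ≤ len x := by
  constructor
  · intro hk
    obtain ⟨y, hy⟩ := Option.ne_none_iff_exists'.mp hk
    have := (h.opPow_spec hx hy).2
    omega
  · intro hk
    obtain ⟨y, hy⟩ := h.exists_opPow hx hk
    simp [hy]

theorem opPow_map (h : IsStringOp S g len) {Φ : X → Y} {g' : Y → Option Y}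
    (hg : ∀ x ∈ S, g' (Φ x) = (g x).map Φ) {x : X} (hx : x ∈ S) (k : ℕ) :
    opPow g' k (Φ x) = (opPow g k x).map Φ := by
  induction k with
  | zero => rfl
  | succ k ih =>
    rw [opPow_succ_last, opPow_succ_last, ih]
    cases hy : opPow g k x with
    | none => rfl
    | some y => exact hg y (h.opPow_spec hx hy).1

theorem stringLength_map (h : IsStringOp S g len) {Φ : X → Y} {g' : Y → Option Y}
    (hg : ∀ x ∈ S, g' (Φ x) = (g x).map Φ) {x : X} (hx : x ∈ S) :
    stringLength g' (Φ x) = len x := by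
  have : {k : ℕ | opPow g' k (Φ x) ≠ none} = Set.Iic (len x) := by
    ext k
    rw [Set.mem_ofPred_eq, h.opPow_map hg hx, Set.mem_Iic, ← h.opPow_ne_none_iff hx]
    simp
  rw [stringLength, this, csSup_Iic]

end IsStringOp

/-- The `ℓ`-strings of the crystal `C` are as in a seminormal crystal: `e_ℓ` and `f_ℓ` are partial
inverses of each other, and `ε_ℓ` and `φ_ℓ` count how often they can be applied. -/
structure Crystal.IsSeminormalAt (C : Crystal X) (ℓ : ℕ) : Prop where
  f_string : IsStringOp C.carrier (C.f ℓ) (C.phi ℓ)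
  e_string : IsStringOp C.carrier (C.e ℓ) (C.eps ℓ)
  e_f : ∀ x ∈ C.carrier, ∀ y, C.f ℓ x = some y → C.e ℓ y = some x
  f_e : ∀ x ∈ C.carrier, ∀ y, C.e ℓ x = some y → C.f ℓ y = some x

namespace Crystal.IsSeminormalAt

variable {C : Crystal X} {ℓ : ℕ}

theorem opPow_e_of_opPow_f (h : C.IsSeminormalAt ℓ) {x y : X} (hx : x ∈ C.carrier) {k : ℕ}
    (hk : opPow (C.f ℓ) k x = some y) : opPow (C.e ℓ) k y = some x := by
  induction k generalizing y with
  | zero => cases hk; rfl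
  | succ k ih =>
    rw [opPow_succ_last, Option.bind_eq_some_iff] at hk
    obtain ⟨z, hz, hzy⟩ := hk
    rw [opPow_succ_of_eq (h.e_f z (h.f_string.opPow_spec hx hz).1 y hzy)]
    exact ih hz

theorem opPow_f_of_opPow_e (h : C.IsSeminormalAt ℓ) {x y : X} (hx : x ∈ C.carrier) {k : ℕ}
    (hk : opPow (C.e ℓ) k x = some y) : opPow (C.f ℓ) k y = some x := by
  induction k generalizing y with
  | zero => cases hk; rfl
  | succ k ih =>
    rw [opPow_succ_last, Option.bind_eq_some_iff] at hk
    obtain ⟨z, hz, hzy⟩ := hk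
    rw [opPow_succ_of_eq (h.f_e z (h.e_string.opPow_spec hx hz).1 y hzy)]
    exact ih hz

end Crystal.IsSeminormalAt

/-- An isomorphism from a seminormal crystal `C` to a crystal `D` in which `φ_j` is the length of
the `f_j`-string commutes with the operators `f_j ^ (φ_j - a)`. -/
theorem IsCrystalIso.fTop_map {n j : ℕ} {C : Crystal X} {D : Crystal Y} {Φ : X → Y}
    (hΦ : IsCrystalIso n C D Φ) (hj : j ≤ n) (hC : C.IsSeminormalAt j)
    (hD : ∀ y, D.phi j y = stringLength (D.f j) y) {x : X} (hx : x ∈ C.carrier) (a : ℕ) :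
    D.fTop j a (Φ x) = (C.fTop j a x).map Φ := by
  have hlen : D.phi j (Φ x) = C.phi j x := by
    rw [hD, hC.f_string.stringLength_map (hΦ.map_f j hj) hx]
  unfold Crystal.fTop
  rw [hlen]
  split_ifs
  · exact hC.f_string.opPow_map (hΦ.map_f j hj) hx _
  · rfl

/-- An isomorphism from a seminormal crystal `C` to a crystal `D` in which `ε_j` is the length of
the `e_j`-string commutes with the operators `e_j ^ (ε_j - a)`. -/
theorem IsCrystalIso.eTop_map {n j : ℕ} {C : Crystal X} {D : Crystal Y} {Φ : X → Y}
    (hΦ : IsCrystalIso n C D Φ) (hj : j ≤ n) (hC : C.IsSeminormalAt j)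
    (hD : ∀ y, D.eps j y = stringLength (D.e j) y) {x : X} (hx : x ∈ C.carrier) (a : ℕ) :
    D.eTop j a (Φ x) = (C.eTop j a x).map Φ := by
  have hlen : D.eps j (Φ x) = C.eps j x := by
    rw [hD, hC.e_string.stringLength_map (hΦ.map_e j hj) hx]
  unfold Crystal.eTop
  rw [hlen]
  split_ifs
  · exact hC.e_string.opPow_map (hΦ.map_e j hj) hx _
  · rfl

/-- A product of operators follows a chain of states `st (t + 1), st t, …, st s`. -/
theorem opProd_eq_some_of_chain {s t : ℕ} (hst : s ≤ t + 1) {g : ℕ → X → Option X} (st : ℕ → X)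
    (h : ∀ j, s ≤ j → j ≤ t → g j (st (j + 1)) = some (st j)) :
    opProd s t g (st (t + 1)) = some (st s) := by
  obtain ⟨d, hd⟩ : ∃ d, t + 1 = s + d := ⟨t + 1 - s, by omega⟩
  rw [opProd, hd, Nat.add_sub_cancel_left]
  induction d generalizing s with
  | zero => simp
  | succ d ih =>
    rw [List.range'_succ, List.foldr_cons, show s + (d + 1) = (s + 1) + d by omega,
      ih (by omega) (fun j hj hjt => h j (by omega) hjt) (by omega)]
    exact h s le_rfl (by omega)

end Strings

/-! ### Path sums through two adjacent lines -/

section TwoLines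

theorem argmaxSet_nonempty {a b : ℕ} (hab : a ≤ b) (v : ℕ → ℕ) : (argmaxSet a b v).Nonempty := by
  obtain ⟨p, hp, hmax⟩ := (Finset.Icc a b).exists_max_image v ⟨a, by simp [hab]⟩
  exact ⟨p, Finset.mem_filter.mpr ⟨hp, hmax⟩⟩

theorem minOr_eq {d : ℕ} {S : Finset ℕ} (h : S.Nonempty) : minOr d S = S.min' h := by
  rw [minOr, ← Finset.coe_min' h, WithTop.untopD_coe]

theorem maxOr_eq {d : ℕ} {S : Finset ℕ} (h : S.Nonempty) : maxOr d S = S.max' h := by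
  rw [maxOr, ← Finset.coe_max' h, WithBot.unbotD_coe]

/-- `p` is the largest point of `[a, b]` at which `v` is maximal. -/
structure IsLastArg (a b : ℕ) (v : ℕ → ℕ) (p : ℕ) : Prop where
  left : a ≤ p
  right : p ≤ b
  le : ∀ q, a ≤ q → q ≤ b → v q ≤ v p
  lt : ∀ q, p < q → q ≤ b → v q < v p

/-- `p` is the smallest point of `[a, b]` at which `v` is maximal. -/
structure IsFirstArg (a b : ℕ) (v : ℕ → ℕ) (p : ℕ) : Prop where
  left : a ≤ p
  right : p ≤ b
  le : ∀ q, a ≤ q → q ≤ b → v q ≤ v p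
  lt : ∀ q, a ≤ q → q < p → v q < v p

theorem isLastArg_maxOr {a b : ℕ} (hab : a ≤ b) (v : ℕ → ℕ) :
    IsLastArg a b v (maxOr 0 (argmaxSet a b v)) := by
  have hne := argmaxSet_nonempty hab v
  rw [maxOr_eq hne]
  have hmem := Finset.mem_filter.mp (Finset.max'_mem _ hne)
  have hI := Finset.mem_Icc.mp hmem.1
  refine ⟨hI.1, hI.2, fun q h1 h2 => hmem.2 q (Finset.mem_Icc.mpr ⟨h1, h2⟩), fun q h1 h2 => ?_⟩
  by_contra hlt
  refine absurd (Finset.le_max' _ q (Finset.mem_filter.mpr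
    ⟨Finset.mem_Icc.mpr ⟨by omega, h2⟩, fun r hr => ?_⟩)) (not_le.mpr h1)
  exact (hmem.2 r hr).trans (not_lt.mp hlt)

theorem isFirstArg_minOr {a b : ℕ} (hab : a ≤ b) (v : ℕ → ℕ) :
    IsFirstArg a b v (minOr 0 (argmaxSet a b v)) := by
  have hne := argmaxSet_nonempty hab v
  rw [minOr_eq hne]
  have hmem := Finset.mem_filter.mp (Finset.min'_mem _ hne)
  have hI := Finset.mem_Icc.mp hmem.1
  refine ⟨hI.1, hI.2, fun q h1 h2 => hmem.2 q (Finset.mem_Icc.mpr ⟨h1, h2⟩), fun q h1 h2 => ?_⟩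
  by_contra hlt
  refine absurd (Finset.min'_le _ q (Finset.mem_filter.mpr
    ⟨Finset.mem_Icc.mpr ⟨h1, by omega⟩, fun r hr => ?_⟩)) (not_le.mpr h2)
  exact (hmem.2 r hr).trans (not_lt.mp hlt)

theorem IsLastArg.unique {a b p q : ℕ} {v : ℕ → ℕ} (hp : IsLastArg a b v p)
    (hq : IsLastArg a b v q) : p = q := by
  rcases lt_trichotomy p q with h | h | h
  · exact absurd (hp.lt q h hq.right) (not_lt.mpr (hq.le p hp.left hp.right))
  · exact h
  · exact absurd (hq.lt p h hp.right) (not_lt.mpr (hp.le q hq.left hq.right))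

theorem IsFirstArg.unique {a b p q : ℕ} {v : ℕ → ℕ} (hp : IsFirstArg a b v p)
    (hq : IsFirstArg a b v q) : p = q := by
  rcases lt_trichotomy p q with h | h | h
  · exact absurd (hq.lt p hp.left h) (not_lt.mpr (hp.le q hq.left hq.right))
  · exact h
  · exact absurd (hp.lt q hq.left h) (not_lt.mpr (hq.le p hp.left hp.right))

/-- The sum along the path which follows the line `u` from `a` to `p`, and then the line `w`
from `p` to `b`. -/
def pathSum (a b : ℕ) (u w : ℕ → ℕ) (p : ℕ) : ℕ :=
  ∑ j ∈ Finset.Icc a p, u j + ∑ j ∈ Finset.Icc p b, w j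

/-- The maximal sum along a path through the lines `u` and `w`. -/
def pathMax (a b : ℕ) (u w : ℕ → ℕ) : ℕ := (Finset.Icc a b).sup (pathSum a b u w)

theorem pathSum_le_pathMax {a b p : ℕ} (u w : ℕ → ℕ) (ha : a ≤ p) (hb : p ≤ b) :
    pathSum a b u w p ≤ pathMax a b u w :=
  Finset.le_sup (f := pathSum a b u w) (Finset.mem_Icc.mpr ⟨ha, hb⟩)

theorem pathMax_eq {a b p : ℕ} {u w : ℕ → ℕ} (ha : a ≤ p) (hb : p ≤ b)
    (h : ∀ q, a ≤ q → q ≤ b → pathSum a b u w q ≤ pathSum a b u w p) :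
    pathMax a b u w = pathSum a b u w p :=
  le_antisymm (Finset.sup_le fun q hq => h q (Finset.mem_Icc.mp hq).1 (Finset.mem_Icc.mp hq).2)
    (pathSum_le_pathMax u w ha hb)

theorem IsLastArg.pathMax_eq {a b p : ℕ} {u w : ℕ → ℕ} (h : IsLastArg a b (pathSum a b u w) p) :
    pathMax a b u w = pathSum a b u w p := KR.pathMax_eq h.left h.right h.le

theorem IsFirstArg.pathMax_eq {a b p : ℕ} {u w : ℕ → ℕ} (h : IsFirstArg a b (pathSum a b u w) p) :
    pathMax a b u w = pathSum a b u w p := KR.pathMax_eq h.left h.right h.le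

theorem sum_Icc_eq_add_sum_Icc {a b c : ℕ} (v : ℕ → ℕ) (hac : a ≤ c + 1) (hcb : c ≤ b) :
    ∑ j ∈ Finset.Icc a b, v j = ∑ j ∈ Finset.Icc a c, v j + ∑ j ∈ Finset.Icc (c + 1) b, v j := by
  rw [← Finset.sum_union]
  · congr 1
    ext j
    simp only [Finset.mem_union, Finset.mem_Icc]
    omega
  · rw [Finset.disjoint_left]
    intro j
    simp only [Finset.mem_Icc]
    omega

theorem sum_Icc_eq_head_add {p b : ℕ} (v : ℕ → ℕ) (h : p ≤ b) :
    ∑ j ∈ Finset.Icc p b, v j = v p + ∑ j ∈ Finset.Icc (p + 1) b, v j := by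
  rw [sum_Icc_eq_add_sum_Icc v (Nat.le_succ p) h, Finset.Icc_self, Finset.sum_singleton]

theorem sum_Icc_add_one {a p : ℕ} (v : ℕ → ℕ) (h : a ≤ p + 1) :
    ∑ j ∈ Finset.Icc a (p + 1), v j = ∑ j ∈ Finset.Icc a p, v j + v (p + 1) := by
  rw [sum_Icc_eq_add_sum_Icc v h (Nat.le_succ p), Finset.Icc_self, Finset.sum_singleton]

/-- `u` is raised by one at `p`. -/
abbrev bump (u : ℕ → ℕ) (p : ℕ) : ℕ → ℕ := Function.update u p (u p + 1)

/-- `u` is lowered by one at `p`. -/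
abbrev drop (u : ℕ → ℕ) (p : ℕ) : ℕ → ℕ := Function.update u p (u p - 1)

theorem bump_drop {u : ℕ → ℕ} {p : ℕ} (h : 0 < u p) : bump (drop u p) p = u := by
  simp [bump, drop, Nat.sub_add_cancel h]

theorem drop_bump (u : ℕ → ℕ) (p : ℕ) : drop (bump u p) p = u := by
  simp [bump, drop]

theorem sum_bump (u : ℕ → ℕ) (p a b : ℕ) :
    ∑ j ∈ Finset.Icc a b, bump u p j
      = ∑ j ∈ Finset.Icc a b, u j + if a ≤ p ∧ p ≤ b then 1 else 0 := by
  split_ifs with h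
  · have hp : p ∈ Finset.Icc a b := Finset.mem_Icc.mpr h
    rw [Finset.sum_update_of_mem hp, ← Finset.add_sum_erase _ _ hp, Finset.sdiff_singleton_eq_erase]
    ring
  · exact Finset.sum_update_of_notMem (fun hp => h (Finset.mem_Icc.mp hp)) _ _

theorem sum_drop {u : ℕ → ℕ} {p : ℕ} (hu : 0 < u p) (a b : ℕ) :
    (∑ j ∈ Finset.Icc a b, drop u p j) + (if a ≤ p ∧ p ≤ b then 1 else 0)
      = ∑ j ∈ Finset.Icc a b, u j := by
  rw [← sum_bump, bump_drop hu]

theorem pathSum_bump_drop {u w : ℕ → ℕ} {p : ℕ} (hw : 0 < w p) (a b q : ℕ) :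
    pathSum a b (bump u p) (drop w p) q + (if q ≤ p ∧ p ≤ b then 1 else 0)
      = pathSum a b u w q + if a ≤ p ∧ p ≤ q then 1 else 0 := by
  have h1 := sum_bump u p a q
  have h2 := sum_drop hw q b
  unfold pathSum
  omega

theorem pathSum_drop_bump {u w : ℕ → ℕ} {p : ℕ} (hu : 0 < u p) (a b q : ℕ) :
    pathSum a b (drop u p) (bump w p) q + (if a ≤ p ∧ p ≤ q then 1 else 0)
      = pathSum a b u w q + if q ≤ p ∧ p ≤ b then 1 else 0 := by
  have h1 := sum_drop hu a q
  have h2 := sum_bump w p q b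
  unfold pathSum
  omega

theorem pathSum_eq_add_pathSum {a r q : ℕ} (b : ℕ) (u w : ℕ → ℕ) (har : a ≤ r) (hrq : r ≤ q) :
    pathSum a b u w q = ∑ j ∈ Finset.Ico a r, u j + pathSum r b u w q := by
  have : ∑ j ∈ Finset.Icc a q, u j = ∑ j ∈ Finset.Ico a r, u j + ∑ j ∈ Finset.Icc r q, u j := by
    rw [← Finset.Ico_add_one_right_eq_Icc, ← Finset.Ico_add_one_right_eq_Icc,
      Finset.sum_Ico_consecutive u har (by omega)]
  unfold pathSum
  omega

theorem sum_le_pathMax_left {a b : ℕ} (u w : ℕ → ℕ) (hab : a ≤ b) :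
    ∑ j ∈ Finset.Icc a b, u j ≤ pathMax a b u w :=
  (Nat.le_add_right _ _).trans (pathSum_le_pathMax u w hab le_rfl)

theorem sum_le_pathMax_right {a b : ℕ} (u w : ℕ → ℕ) (hab : a ≤ b) :
    ∑ j ∈ Finset.Icc a b, w j ≤ pathMax a b u w :=
  (Nat.le_add_left _ _).trans (pathSum_le_pathMax u w le_rfl hab)

/-- At the last maximizing point there is something to be moved from `w` to `u`, unless the line
`u` itself is a maximal path. -/
theorem IsLastArg.pos {a b p : ℕ} {u w : ℕ → ℕ} (h : IsLastArg a b (pathSum a b u w) p)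
    (hlt : ∑ j ∈ Finset.Icc a b, u j < pathMax a b u w) : 0 < w p := by
  rw [h.pathMax_eq] at hlt
  rcases h.right.eq_or_lt with rfl | hpb
  · simpa [pathSum] using hlt
  · have h1 := h.lt (p + 1) (Nat.lt_succ_self p) hpb
    have h2 := sum_Icc_add_one u (a := a) (p := p) (by have := h.left; omega)
    have h3 := sum_Icc_eq_head_add w hpb.le
    unfold pathSum at h1
    omega

theorem IsFirstArg.pos {a b p : ℕ} {u w : ℕ → ℕ} (h : IsFirstArg a b (pathSum a b u w) p)
    (hlt : ∑ j ∈ Finset.Icc a b, w j < pathMax a b u w) : 0 < u p := by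
  rw [h.pathMax_eq] at hlt
  rcases h.left.eq_or_lt with rfl | hpb
  · simpa [pathSum] using hlt
  · obtain ⟨p, rfl⟩ : ∃ p', p = p' + 1 := ⟨p - 1, by omega⟩
    have h1 := h.lt p (by omega) (Nat.lt_succ_self p)
    have h2 := sum_Icc_add_one u (a := a) (p := p) (by omega)
    have h3 := sum_Icc_eq_head_add w (Nat.le_of_succ_le h.right)
    unfold pathSum at h1
    omega

theorem IsLastArg.isFirstArg_bump_drop {a b p : ℕ} {u w : ℕ → ℕ}
    (h : IsLastArg a b (pathSum a b u w) p) (hw : 0 < w p) :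
    IsFirstArg a b (pathSum a b (bump u p) (drop w p)) p := by
  have hp := pathSum_bump_drop (u := u) hw a b p
  have h1 := h.left
  have h2 := h.right
  simp only [le_refl, h1, h2, and_self, if_true] at hp
  refine ⟨h1, h2, fun q ha hb => ?_, fun q ha hb => ?_⟩
  · have hq := pathSum_bump_drop (u := u) hw a b q
    have h3 := h.le q ha hb
    by_cases hpq : p < q
    · have h4 := h.lt q hpq hb
      simp only [h1, h2, hpq.le, not_le.mpr hpq, and_self, false_and, if_true, if_false] at hq
      omega
    · split_ifs at hq <;> omega
  · have hq := pathSum_bump_drop (u := u) hw a b q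
    have h3 := h.le q ha (by omega)
    simp only [h1, h2, hb.le, not_le.mpr hb, and_self, and_false, if_true, if_false] at hq
    omega

theorem IsFirstArg.isLastArg_drop_bump {a b p : ℕ} {u w : ℕ → ℕ}
    (h : IsFirstArg a b (pathSum a b u w) p) (hu : 0 < u p) :
    IsLastArg a b (pathSum a b (drop u p) (bump w p)) p := by
  have hp := pathSum_drop_bump (w := w) hu a b p
  have h1 := h.left
  have h2 := h.right
  simp only [le_refl, h1, h2, and_self, if_true] at hp
  refine ⟨h1, h2, fun q ha hb => ?_, fun q ha hb => ?_⟩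
  · have hq := pathSum_drop_bump (w := w) hu a b q
    have h3 := h.le q ha hb
    by_cases hpq : q < p
    · have h4 := h.lt q ha hpq
      simp only [h1, h2, hpq.le, not_le.mpr hpq, and_self, and_false, if_true, if_false] at hq
      omega
    · split_ifs at hq <;> omega
  · have hq := pathSum_drop_bump (w := w) hu a b q
    have h3 := h.le q (by omega) hb
    simp only [h1, h2, ha.le, not_le.mpr ha, and_self, false_and, if_true, if_false] at hq
    omega

theorem IsLastArg.pathMax_bump_drop {a b p : ℕ} {u w : ℕ → ℕ}
    (h : IsLastArg a b (pathSum a b u w) p) (hw : 0 < w p) :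
    pathMax a b (bump u p) (drop w p) = pathMax a b u w := by
  rw [(h.isFirstArg_bump_drop hw).pathMax_eq, h.pathMax_eq]
  have hp := pathSum_bump_drop (u := u) hw a b p
  have h1 := h.left
  have h2 := h.right
  simpa [h1, h2] using hp

theorem IsFirstArg.pathMax_drop_bump {a b p : ℕ} {u w : ℕ → ℕ}
    (h : IsFirstArg a b (pathSum a b u w) p) (hu : 0 < u p) :
    pathMax a b (drop u p) (bump w p) = pathMax a b u w := by
  rw [(h.isLastArg_drop_bump hu).pathMax_eq, h.pathMax_eq]
  have hp := pathSum_drop_bump (w := w) hu a b p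
  have h1 := h.left
  have h2 := h.right
  simpa [h1, h2] using hp

/-- Moving one unit from `w` to `u` at the last maximizing point preserves the maximal path sums
on all final segments `[r, b]`. -/
theorem IsLastArg.pathMax_tail_bump_drop {a b p r : ℕ} {u w : ℕ → ℕ}
    (h : IsLastArg a b (pathSum a b u w) p) (hw : 0 < w p) (har : a ≤ r) :
    pathMax r b (bump u p) (drop w p) = pathMax r b u w := by
  rcases lt_or_ge p r with hpr | hrp
  · refine Finset.sup_congr rfl fun q hq => ?_
    have hrq := (Finset.mem_Icc.mp hq).1
    have := pathSum_bump_drop (u := u) hw r b q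
    rw [if_neg (by omega), if_neg (by omega)] at this
    exact this
  · have hr : IsLastArg r b (pathSum r b u w) p := by
      have hp := pathSum_eq_add_pathSum b u w har hrp
      refine ⟨hrp, h.right, fun q h1 h2 => ?_, fun q h1 h2 => ?_⟩
      · have := h.le q (har.trans h1) h2
        have := pathSum_eq_add_pathSum b u w har h1
        omega
      · have := h.lt q h1 h2
        have := pathSum_eq_add_pathSum b u w har (hrp.trans h1.le)
        omega
    exact hr.pathMax_bump_drop hw

/-- If the line `u` is a maximal path, then so are its final segments. -/
theorem pathMax_tail_eq_sum {a b r : ℕ} {u w : ℕ → ℕ} (har : a ≤ r) (hrb : r ≤ b)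
    (h : pathMax a b u w = ∑ j ∈ Finset.Icc a b, u j) :
    pathMax r b u w = ∑ j ∈ Finset.Icc r b, u j := by
  refine le_antisymm (Finset.sup_le fun q hq => ?_) (sum_le_pathMax_left u w hrb)
  obtain ⟨h1, h2⟩ := Finset.mem_Icc.mp hq
  have h3 := pathSum_le_pathMax u w (har.trans h1) h2
  have h4 := pathSum_eq_add_pathSum b u w har h1
  have h5 := pathSum_eq_add_pathSum b u (fun _ => 0) har hrb
  have h6 : pathSum a b u (fun _ => 0) b = ∑ j ∈ Finset.Icc a b, u j := by simp [pathSum]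
  have h7 : pathSum r b u (fun _ => 0) b = ∑ j ∈ Finset.Icc r b, u j := by simp [pathSum]
  omega

end TwoLines

/-! ### Potentials bounding the sums along Dyck paths -/

/-- The pattern `A` has a potential `g` with value at most `m` at `(I, N)`: a function growing by
at least the new entry along every step to the right or upwards. This bounds all path
sums that end in `(I, N)`, and unlike the definition through Dyck paths it is visibly symmetric in
the two coordinates. -/
def HasPotential (I N m : ℕ) (A : Pattern) : Prop :=
  ∃ g : ℕ → ℕ → ℤ, (∀ p q, (A p q : ℤ) ≤ g p q) ∧
    (∀ p q, g p q + A (p + 1) q ≤ g (p + 1) q) ∧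
    (∀ p q, g p q + A p (q + 1) ≤ g p (q + 1)) ∧ g I N ≤ m

/-- The pattern with columns and rows exchanged. -/
def transpose (A : Pattern) : Pattern := fun p q => A q p

theorem HasPotential.transpose {I N m : ℕ} {A : Pattern} (h : HasPotential I N m A) :
    HasPotential N I m (transpose A) := by
  obtain ⟨g, h1, h2, h3, h4⟩ := h
  exact ⟨fun p q => g q p, fun p q => h1 q p, fun p q => h3 q p, fun p q => h2 q p, h4⟩

theorem HasPotential.mono {I N m : ℕ} {A B : Pattern} (h : HasPotential I N m A)
    (hBA : ∀ p q, B p q ≤ A p q) : HasPotential I N m B := by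
  obtain ⟨g, h1, h2, h3, h4⟩ := h
  have hc : ∀ p q, (B p q : ℤ) ≤ A p q := fun p q => by exact_mod_cast hBA p q
  exact ⟨g, fun p q => (hc p q).trans (h1 p q),
    fun p q => (add_le_add_right (hc (p + 1) q) _).trans (h2 p q),
    fun p q => (add_le_add_right (hc p (q + 1)) _).trans (h3 p q), h4⟩

theorem potential_add_sum_le {A : Pattern} {g : ℕ → ℕ → ℤ} {x : ℕ}
    (h : ∀ q, g x q + A x (q + 1) ≤ g x (q + 1)) {y y' : ℕ} (hy : y ≤ y') :
    g x y + ((∑ j ∈ Finset.Icc (y + 1) y', A x j : ℕ) : ℤ) ≤ g x y' := by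
  induction y', hy using Nat.le_induction with
  | base => simp
  | succ y' hy ih =>
    rw [sum_Icc_add_one _ (by omega)]
    push_cast at ih ⊢
    linarith [h y']

/-- The greatest sum along a path which starts anywhere and ends in `(p, q)`. -/
def lastPassage (A : Pattern) : ℕ → ℕ → ℕ
  | 0, 0 => A 0 0
  | p + 1, 0 => lastPassage A p 0 + A (p + 1) 0
  | 0, q + 1 => lastPassage A 0 q + A 0 (q + 1)
  | p + 1, q + 1 =>
    max (lastPassage A p (q + 1)) (lastPassage A (p + 1) q) + A (p + 1) (q + 1)

theorem lastPassage_eq_zero {A : Pattern} {p q : ℕ}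
    (h : ∀ p' ≤ p, ∀ q' ≤ q, A p' q' = 0) : lastPassage A p q = 0 := by
  induction p generalizing q with
  | zero =>
    induction q with
    | zero => simpa [lastPassage] using h 0 le_rfl 0 le_rfl
    | succ q ih =>
      rw [lastPassage, ih fun p' hp q' hq => h p' hp q' (by omega), h 0 le_rfl (q + 1) le_rfl]
  | succ p ih =>
    induction q with
    | zero =>
      rw [lastPassage, ih fun p' hp q' hq => h p' (by omega) q' hq, h (p + 1) le_rfl 0 le_rfl]
    | succ q ih2 =>
      rw [lastPassage, ih fun p' hp q' hq => h p' (by omega) q' hq,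
        ih2 fun p' hp q' hq => h p' hp q' (by omega), h (p + 1) le_rfl (q + 1) le_rfl]
      rfl

/-- The value of `lastPassage` at a point of the quadrant with corner `(1, i)` is attained along a
path starting in that corner, if the pattern vanishes outside the quadrant. -/
theorem exists_path_sum_eq_lastPassage {i : ℕ} {A : Pattern}
    (hA : ∀ p q, p < 1 ∨ q < i → A p q = 0) (p q r : ℕ) (hp : 1 ≤ p) (hq : i ≤ q)
    (hr : p + q = i + r) :
    ∃ β : ℕ → ℕ × ℕ, β 1 = (1, i) ∧ β r = (p, q) ∧
      (∀ s, 1 ≤ s → s < r →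
        β (s + 1) = ((β s).1, (β s).2 + 1) ∨ β (s + 1) = ((β s).1 + 1, (β s).2)) ∧
      ∑ s ∈ Finset.Icc 1 r, A (β s).1 (β s).2 = lastPassage A p q := by
  induction r generalizing p q with
  | zero => omega
  | succ r ih =>
    have zero_left : ∀ q', lastPassage A 0 q' = 0 := fun q' =>
      lastPassage_eq_zero fun p' hp' _ _ => hA _ _ (Or.inl (by omega))
    have zero_below : ∀ p' q', q' < i → lastPassage A p' q' = 0 := fun p' q' hq' =>
      lastPassage_eq_zero fun _ _ q'' hq'' => hA _ _ (Or.inr (by omega))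
    have extend : ∀ (p' q' : ℕ), 1 ≤ p' → i ≤ q' → p' + q' = i + r →
        ((p, q) = (p', q' + 1) ∨ (p, q) = (p' + 1, q')) →
        lastPassage A p q = lastPassage A p' q' + A p q →
        ∃ β : ℕ → ℕ × ℕ, β 1 = (1, i) ∧ β (r + 1) = (p, q) ∧
          (∀ s, 1 ≤ s → s < r + 1 →
            β (s + 1) = ((β s).1, (β s).2 + 1) ∨ β (s + 1) = ((β s).1 + 1, (β s).2)) ∧
          ∑ s ∈ Finset.Icc 1 (r + 1), A (β s).1 (β s).2 = lastPassage A p q := by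
      intro p' q' hp' hq' hr' hpq hval
      obtain ⟨β, h1, h2, h3, h4⟩ := ih p' q' hp' hq' hr'
      refine ⟨fun s => if s ≤ r then β s else (p, q), ?_, ?_, ?_, ?_⟩
      · rw [← h1]; exact if_pos (by omega)
      · exact if_neg (by omega)
      · intro s hs hsr
        rcases Nat.lt_or_ge s r with h | h
        · simpa only [if_pos h.le, if_pos (Nat.succ_le_of_lt h)] using h3 s hs h
        · obtain rfl : s = r := by omega
          simpa only [le_refl, if_true, h2, if_neg (Nat.not_succ_le_self s)] using hpq
      · rw [sum_Icc_add_one _ (by omega), hval, ← h4]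
        congr 1
        · exact Finset.sum_congr rfl fun s hs => by simp only [if_pos (Finset.mem_Icc.mp hs).2]
        · simp only [if_neg (Nat.not_succ_le_self r)]
    obtain ⟨p, rfl⟩ : ∃ p', p = p' + 1 := ⟨p - 1, by omega⟩
    rcases Nat.eq_zero_or_pos q with rfl | hq0
    · rcases Nat.eq_zero_or_pos p with rfl | hp0
      · obtain rfl : r = 0 := by omega
        obtain rfl : i = 0 := by omega
        exact ⟨fun _ => (1, 0), rfl, rfl, fun s h1 h2 => by omega,
          by simp [lastPassage, hA 0 0 (Or.inl one_pos)]⟩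
      · exact extend p 0 hp0 hq (by omega) (Or.inr rfl) (by rw [lastPassage])
    · obtain ⟨q, rfl⟩ : ∃ q', q = q' + 1 := ⟨q - 1, by omega⟩
      rcases Nat.eq_zero_or_pos p with rfl | hp0
      · rcases hq.eq_or_lt with rfl | hlt
        · obtain rfl : r = 0 := by omega
          exact ⟨fun _ => (1, q + 1), rfl, rfl, fun s h1 h2 => by omega,
            by simp [lastPassage, zero_left, zero_below 1 q (Nat.lt_succ_self q)]⟩
        · exact extend 1 q le_rfl (by omega) (by omega) (Or.inl rfl)
            (by simp [lastPassage, zero_left])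
      · rcases hq.eq_or_lt with rfl | hlt
        · exact extend p (q + 1) hp0 le_rfl (by omega) (Or.inr rfl)
            (by simp [lastPassage, zero_below (p + 1) q (Nat.lt_succ_self q)])
        · rcases le_total (lastPassage A p (q + 1)) (lastPassage A (p + 1) q) with h | h
          · exact extend (p + 1) q hp (by omega) (by omega) (Or.inl rfl)
              (by rw [lastPassage, max_eq_right h])
          · exact extend p (q + 1) hp0 hq (by omega) (Or.inr rfl)
              (by rw [lastPassage, max_eq_left h])

theorem hasPotential_of_dyck {n i m : ℕ} (hi : 1 ≤ i) (hin : i ≤ n) {A : Pattern}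
    (hA : A ∈ polytope n i m) : HasPotential i n m A := by
  refine ⟨fun p q => lastPassage A p q, fun p q => ?_, fun p q => ?_, fun p q => ?_, ?_⟩
  · cases p <;> cases q <;> simp [lastPassage]
  · cases q <;> simp [lastPassage]
  · cases p <;> simp [lastPassage]
  · obtain ⟨β, h1, h2, h3, h4⟩ := exists_path_sum_eq_lastPassage (i := i) (A := A)
      (fun p q h => hA.1 p q (by omega)) i n n hi hin rfl
    have := hA.2 β ⟨h1, h2, h3⟩
    rw [h4] at this
    exact Int.ofNat_le.mpr this

theorem dyck_sum_le {n i m : ℕ} (hn : 1 ≤ n) {A : Pattern} (hA : HasPotential i n m A)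
    {β : ℕ → ℕ × ℕ} (hβ : IsDyckPath n i β) :
    ∑ r ∈ Finset.Icc 1 n, A (β r).1 (β r).2 ≤ m := by
  obtain ⟨g, g1, g2, g3, g4⟩ := hA
  obtain ⟨-, h2, h3⟩ := hβ
  have key : ∀ r, 1 ≤ r → r ≤ n →
      ((∑ s ∈ Finset.Icc 1 r, A (β s).1 (β s).2 : ℕ) : ℤ) ≤ g (β r).1 (β r).2 := by
    intro r hr
    induction r, hr using Nat.le_induction with
    | base => intro _; simpa using g1 _ _
    | succ r hr ih =>
      intro hrn
      have := ih (by omega)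
      rw [sum_Icc_add_one _ (by omega)]
      push_cast at this ⊢
      rcases h3 r hr (by omega) with h | h <;> rw [h]
      · linarith [g3 (β r).1 (β r).2]
      · linarith [g2 (β r).1 (β r).2]
  have := key n hn le_rfl
  rw [h2] at this
  exact_mod_cast this.trans g4

theorem mem_polytope_iff {n i m : ℕ} (hi : 1 ≤ i) (hin : i ≤ n) {A : Pattern} :
    A ∈ polytope n i m ↔ (∀ p q, ¬ (1 ≤ p ∧ p ≤ i ∧ i ≤ q ∧ q ≤ n) → A p q = 0) ∧
      HasPotential i n m A :=
  ⟨fun h => ⟨h.1, hasPotential_of_dyck hi hin h⟩,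
    fun h => ⟨h.1, fun _ hβ => dyck_sum_le (hi.trans hin) h.2 hβ⟩⟩

/-! ### Moving a unit between adjacent columns -/

/-- Move one unit in row `p` from column `c + 1` to column `c`. -/
def moveLeft (c p : ℕ) (A : Pattern) : Pattern := dec (inc A c p) (c + 1) p

/-- Move one unit in row `p` from column `c` to column `c + 1`. -/
def moveRight (c p : ℕ) (A : Pattern) : Pattern := inc (dec A c p) (c + 1) p

theorem moveLeft_left (c p : ℕ) (A : Pattern) : moveLeft c p A c = bump (A c) p := by
  funext q
  by_cases h : q = p <;> simp [moveLeft, dec, inc, setEntry, h]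

theorem moveLeft_right (c p : ℕ) (A : Pattern) : moveLeft c p A (c + 1) = drop (A (c + 1)) p := by
  funext q
  by_cases h : q = p <;> simp [moveLeft, dec, inc, setEntry, h]

theorem moveLeft_of_ne {c p d : ℕ} (A : Pattern) (h1 : d ≠ c) (h2 : d ≠ c + 1) :
    moveLeft c p A d = A d := by
  funext q
  simp [moveLeft, dec, inc, setEntry, h1, h2]

theorem moveRight_left (c p : ℕ) (A : Pattern) : moveRight c p A c = drop (A c) p := by
  funext q
  by_cases h : q = p <;> simp [moveRight, dec, inc, setEntry, h]

theorem moveRight_right (c p : ℕ) (A : Pattern) :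
    moveRight c p A (c + 1) = bump (A (c + 1)) p := by
  funext q
  by_cases h : q = p <;> simp [moveRight, dec, inc, setEntry, h]

theorem moveRight_of_ne {c p d : ℕ} (A : Pattern) (h1 : d ≠ c) (h2 : d ≠ c + 1) :
    moveRight c p A d = A d := by
  funext q
  simp [moveRight, dec, inc, setEntry, h1, h2]

theorem moveRight_moveLeft {c p : ℕ} {A : Pattern} (h : 0 < A (c + 1) p) :
    moveRight c p (moveLeft c p A) = A := by
  funext d
  rcases eq_or_ne d c with rfl | h1
  · rw [moveRight_left, moveLeft_left, drop_bump]
  rcases eq_or_ne d (c + 1) with rfl | h2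
  · rw [moveRight_right, moveLeft_right, bump_drop h]
  · rw [moveRight_of_ne _ h1 h2, moveLeft_of_ne _ h1 h2]

theorem moveLeft_moveRight {c p : ℕ} {A : Pattern} (h : 0 < A c p) :
    moveLeft c p (moveRight c p A) = A := by
  funext d
  rcases eq_or_ne d c with rfl | h1
  · rw [moveLeft_left, moveRight_left, bump_drop h]
  rcases eq_or_ne d (c + 1) with rfl | h2
  · rw [moveLeft_right, moveRight_right, drop_bump]
  · rw [moveLeft_of_ne _ h1 h2, moveRight_of_ne _ h1 h2]

/-- Behind the last maximizing point, the line `w` exceeds the line `u` by at least one. -/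
theorem IsLastArg.sum_lt {a b p r : ℕ} {u w : ℕ → ℕ} (h : IsLastArg a b (pathSum a b u w) p)
    (hlt : ∑ j ∈ Finset.Icc a b, u j < pathMax a b u w) (hu : ∀ q, b < q → u q = 0)
    (hw : ∀ q, b < q → w q = 0) (hpr : p < r) :
    ∑ j ∈ Finset.Icc (p + 1) r, u j + 1 + w r ≤ ∑ j ∈ Finset.Icc p r, w j := by
  have ha := h.left
  have hb := h.right
  rcases le_or_gt r b with hrb | hbr
  · have h1 := h.lt r hpr hrb
    have h2 := sum_Icc_eq_add_sum_Icc u (a := a) (c := p) (b := r) (by omega) hpr.le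
    have h3 := sum_Icc_eq_add_sum_Icc w (a := p) (c := r) (b := b) (by omega) hrb
    have h4 := sum_Icc_eq_head_add w hrb
    unfold pathSum at h1
    omega
  · rw [h.pathMax_eq, pathSum] at hlt
    have h2 := sum_Icc_eq_add_sum_Icc u (a := p + 1) (c := b) (b := r) (by omega) hbr.le
    have h3 := sum_Icc_eq_add_sum_Icc w (a := p) (c := b) (b := r) (by omega) hbr.le
    have h4 := sum_Icc_eq_add_sum_Icc u (a := a) (c := p) (b := b) (by omega) hb
    have h5 : ∑ j ∈ Finset.Icc (b + 1) r, u j = 0 :=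
      Finset.sum_eq_zero fun j hj => hu j (Finset.mem_Icc.mp hj).1
    have h6 : ∑ j ∈ Finset.Icc (b + 1) r, w j = 0 :=
      Finset.sum_eq_zero fun j hj => hw j (Finset.mem_Icc.mp hj).1
    have h7 := hw r hbr
    omega

/-- Before the first maximizing point, the line `u` exceeds the line `w` by at least one. -/
theorem IsFirstArg.sum_lt {a b p r : ℕ} {u w : ℕ → ℕ} (h : IsFirstArg a b (pathSum a b u w) p)
    (hlt : ∑ j ∈ Finset.Icc a b, w j < pathMax a b u w) (hu : ∀ q, q < a → u q = 0)
    (hw : ∀ q, q < a → w q = 0) (hrp : r < p) :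
    ∑ j ∈ Finset.Icc r p, w j + 1 ≤ ∑ j ∈ Finset.Icc (r + 1) p, u j + w p := by
  have ha := h.left
  have hb := h.right
  rcases le_or_gt a r with har | hra
  · have h1 := h.lt r har hrp
    have h2 := sum_Icc_eq_add_sum_Icc u (a := a) (c := r) (b := p) (by omega) hrp.le
    have h3 := sum_Icc_eq_add_sum_Icc w (a := r) (c := p) (b := b) (by omega) hb
    have h4 := sum_Icc_eq_head_add w hb
    unfold pathSum at h1
    omega
  · obtain ⟨a, rfl⟩ : ∃ a', a = a' + 1 := ⟨a - 1, by omega⟩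
    rw [h.pathMax_eq, pathSum] at hlt
    have h2 := sum_Icc_eq_add_sum_Icc u (a := r + 1) (c := a) (b := p) (by omega) (by omega)
    have h3 := sum_Icc_eq_add_sum_Icc w (a := r) (c := a) (b := p) (by omega) (by omega)
    have h4 := sum_Icc_eq_add_sum_Icc w (a := a + 1) (c := p) (b := b) (by omega) hb
    have h5 : ∑ j ∈ Finset.Icc (r + 1) a, u j = 0 :=
      Finset.sum_eq_zero fun j hj => hu j (by have := Finset.mem_Icc.mp hj; omega)
    have h6 : ∑ j ∈ Finset.Icc r a, w j = 0 :=
      Finset.sum_eq_zero fun j hj => hw j (by have := Finset.mem_Icc.mp hj; omega)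
    have h7 := sum_Icc_eq_head_add w hb
    omega

/-- Moving a unit to the left at the last maximizing point preserves the path bound: only the
potential in column `c`, from row `p` on, has to be increased. -/
theorem HasPotential.moveLeft {I N m a b c p : ℕ} {A : Pattern} (hA : HasPotential I N m A)
    (hcI : c + 1 ≤ I) (hu : ∀ q, b < q → A c q = 0) (hw : ∀ q, b < q → A (c + 1) q = 0)
    (hp : IsLastArg a b (pathSum a b (A c) (A (c + 1))) p)
    (hlt : ∑ j ∈ Finset.Icc a b, A c j < pathMax a b (A c) (A (c + 1))) :
    HasPotential I N m (moveLeft c p A) := by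
  have hpos := hp.pos hlt
  obtain ⟨g, g1, g2, g3, g4⟩ := hA
  have key : ∀ r, p < r → g c p + 1 + ((∑ j ∈ Finset.Icc (p + 1) r, A c j : ℕ) : ℤ)
      + A (c + 1) r ≤ g (c + 1) r := by
    intro r hr
    have h1 := hp.sum_lt hlt hu hw hr
    have h2 := potential_add_sum_le (g3 (c + 1)) hr.le
    have h3 := sum_Icc_eq_head_add (A (c + 1)) hr.le
    have h4 := g2 c p
    have h5 : ((∑ j ∈ Finset.Icc (p + 1) r, A c j : ℕ) : ℤ) + 1 + A (c + 1) r
        ≤ A (c + 1) p + ((∑ j ∈ Finset.Icc (p + 1) r, A (c + 1) j : ℕ) : ℤ) := by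
      rw [h3] at h1
      exact_mod_cast h1
    linarith
  set B := KR.moveLeft c p A with hB
  have hBl : ∀ q, (B c q : ℤ) = A c q + if q = p then 1 else 0 := by
    intro q
    rw [hB, moveLeft_left, bump, Function.update_apply]
    split_ifs with h
    · subst h; push_cast; ring
    · simp
  have hBr : ∀ q, (B (c + 1) q : ℤ) = A (c + 1) q - if q = p then 1 else 0 := by
    intro q
    rw [hB, moveLeft_right, drop, Function.update_apply]
    split_ifs with h
    · subst h; push_cast [Nat.cast_sub hpos]; ring
    · simp
  have hBo : ∀ d, d ≠ c → d ≠ c + 1 → B d = A d := fun d h1 h2 => moveLeft_of_ne A h1 h2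
  refine ⟨fun x y => if x = c ∧ p ≤ y then
    max (g c y) (g c p + 1 + ((∑ j ∈ Finset.Icc (p + 1) y, A c j : ℕ) : ℤ)) else g x y,
    ?_, ?_, ?_, ?_⟩
  · intro x y
    rcases eq_or_ne x c with rfl | hxc
    · have := g1 x y
      rcases lt_trichotomy y p with h | rfl | h
      · simp only [hBl, h.ne, not_le.mpr h, and_false, if_false]; linarith
      · simp only [hBl, le_refl, and_self, if_true]
        exact le_trans (by simp; linarith) (le_max_right _ _)
      · simp only [hBl, h.ne', h.le, and_self, if_true, if_false]
        exact le_trans (by linarith) (le_max_left _ _)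
    · have := g1 x y
      simp only [hxc, false_and, if_false]
      rcases eq_or_ne x (c + 1) with rfl | hxc'
      · rw [hBr]; split_ifs <;> linarith
      · rwa [hBo x hxc hxc']
  · intro x y
    have h2 := g2 x y
    rcases eq_or_ne x c with rfl | hxc
    · simp only [hBr, (Nat.succ_ne_self x), false_and, if_false, true_and]
      rcases lt_trichotomy y p with h | rfl | h
      · simp only [h.ne, not_le.mpr h, if_false]; linarith
      · simp only [le_refl, if_true, Finset.Icc_eq_empty (Nat.not_succ_le_self y),
          Finset.sum_empty, Nat.cast_zero]
        rw [max_eq_right (by linarith)]; linarith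
      · simp only [h.ne', h.le, if_true, if_false]
        have := key y h
        rcases max_choice (g x y) (g x p + 1 + ((∑ j ∈ Finset.Icc (p + 1) y, A x j : ℕ) : ℤ))
          with h | h <;> rw [h] <;> linarith
    · simp only [hxc, false_and, if_false]
      rcases eq_or_ne (x + 1) c with rfl | hxc'
      · simp only [hBl, true_and]
        rcases lt_trichotomy y p with h | rfl | h
        · simp only [h.ne, not_le.mpr h, if_false]; linarith
        · simp only [le_refl, if_true]
          exact le_trans (by simp; linarith) (le_max_right _ _)
        · simp only [h.ne', h.le, if_true, if_false]
          exact le_trans (by linarith) (le_max_left _ _)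
      · rw [if_neg (fun h => hxc' h.1), hBo _ hxc' (by omega)]
        exact h2
  · intro x y
    have h3 := g3 x y
    rcases eq_or_ne x c with rfl | hxc
    · simp only [hBl, true_and]
      rcases lt_trichotomy (y + 1) p with h | rfl | h
      · simp only [h.ne, not_le.mpr h, not_le.mpr ((Nat.lt_succ_self y).trans h), if_false]
        linarith
      · simp only [le_refl, if_true, Nat.not_succ_le_self, if_false]
        exact le_trans (by simp; linarith) (le_max_right _ _)
      · have hpy : p ≤ y := Nat.le_of_lt_succ h
        simp only [h.ne', h.le, hpy, if_true, if_false]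
        rw [sum_Icc_add_one _ (by omega)]
        push_cast
        rcases max_choice (g x y) (g x p + 1 + (∑ j ∈ Finset.Icc (p + 1) y, (A x j : ℤ)))
          with h | h <;> rw [h]
        · exact le_trans (by linarith) (le_max_left _ _)
        · exact le_trans (by linarith) (le_max_right _ _)
    · simp only [hxc, false_and, if_false]
      rcases eq_or_ne x (c + 1) with rfl | hxc'
      · rw [hBr]; split_ifs <;> linarith
      · rwa [hBo x hxc hxc']
  · simpa only [show I ≠ c by omega, false_and, if_false] using g4

/-- Moving a unit to the right at the first maximizing point preserves the path bound: the
potential in column `c + 1` has to be decreased below row `p`. -/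
theorem HasPotential.moveRight {I N m a b c p : ℕ} {A : Pattern} (hA : HasPotential I N m A)
    (hu : ∀ q, q < a → A c q = 0) (hw : ∀ q, q < a → A (c + 1) q = 0)
    (hp : IsFirstArg a b (pathSum a b (A c) (A (c + 1))) p)
    (hlt : ∑ j ∈ Finset.Icc a b, A (c + 1) j < pathMax a b (A c) (A (c + 1))) :
    HasPotential I N m (moveRight c p A) := by
  have hpos := hp.pos hlt
  obtain ⟨g, g1, g2, g3, g4⟩ := hA
  have key : ∀ r, r < p → g c r + A (c + 1) r + 1
      + ((∑ j ∈ Finset.Icc (r + 1) p, A (c + 1) j : ℕ) : ℤ) ≤ g (c + 1) p := by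
    intro r hr
    have h1 := hp.sum_lt hlt hu hw hr
    have h2 := potential_add_sum_le (g3 c) hr.le
    have h3 := sum_Icc_eq_head_add (A (c + 1)) hr.le
    have h4 := g2 c p
    have h5 : A (c + 1) r + ((∑ j ∈ Finset.Icc (r + 1) p, A (c + 1) j : ℕ) : ℤ) + 1
        ≤ ((∑ j ∈ Finset.Icc (r + 1) p, A c j : ℕ) : ℤ) + A (c + 1) p := by
      rw [h3] at h1
      exact_mod_cast h1
    linarith
  set B := KR.moveRight c p A with hB
  have hBl : ∀ q, (B c q : ℤ) = A c q - if q = p then 1 else 0 := by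
    intro q
    rw [hB, moveRight_left, drop, Function.update_apply]
    split_ifs with h
    · subst h; push_cast [Nat.cast_sub hpos]; ring
    · simp
  have hBr : ∀ q, (B (c + 1) q : ℤ) = A (c + 1) q + if q = p then 1 else 0 := by
    intro q
    rw [hB, moveRight_right, bump, Function.update_apply]
    split_ifs with h
    · subst h; push_cast; ring
    · simp
  have hBo : ∀ d, d ≠ c → d ≠ c + 1 → B d = A d := fun d h1 h2 => moveRight_of_ne A h1 h2
  set g' : ℕ → ℕ → ℤ := fun x y => if x = c + 1 ∧ y < p then
    min (g (c + 1) y) (g (c + 1) p - 1 - ((∑ j ∈ Finset.Icc (y + 1) p, A (c + 1) j : ℕ) : ℤ))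
    else if x = c ∧ y = p then g c p - 1 else g x y with hg'
  have gle : ∀ x y, g' x y ≤ g x y := by
    intro x y
    simp only [hg']
    split_ifs with h h'
    · rw [h.1]; exact min_le_left _ _
    · rw [h'.1, h'.2]; linarith
    · exact le_rfl
  have gl : ∀ y, g' c y = g c y - if y = p then 1 else 0 := by
    intro y
    simp only [hg', (Nat.succ_ne_self c).symm, false_and, if_false, true_and]
    split_ifs with h
    · rw [h]
    · simp
  have gr : ∀ y, y < p → g' (c + 1) y = min (g (c + 1) y)
      (g (c + 1) p - 1 - ((∑ j ∈ Finset.Icc (y + 1) p, A (c + 1) j : ℕ) : ℤ)) := by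
    intro y h
    simp only [hg', h, and_self, if_true]
  have gr' : ∀ y, p ≤ y → g' (c + 1) y = g (c + 1) y := by
    intro y h
    simp only [hg', not_lt.mpr h, and_false, if_false, Nat.succ_ne_self, false_and]
  have go : ∀ x y, x ≠ c → x ≠ c + 1 → g' x y = g x y := by
    intro x y h1 h2
    simp only [hg', h1, h2, false_and, if_false]
  refine ⟨g', ?_, ?_, ?_, (gle I N).trans g4⟩
  · intro x y
    have h1 := g1 x y
    rcases eq_or_ne x c with rfl | hxc
    · rw [hBl, gl]; linarith
    rcases eq_or_ne x (c + 1) with rfl | hxc'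
    · rw [hBr]
      rcases lt_trichotomy y p with h | rfl | h
      · rw [gr y h, if_neg h.ne, add_zero]
        have h2 := key y h
        have h3 : (0 : ℤ) ≤ g c y := le_trans (Int.natCast_nonneg _) (g1 c y)
        exact le_min h1 (by linarith)
      · rw [gr' y le_rfl, if_pos rfl]
        have h2 := g2 c y
        have h3 := g1 c y
        have h4 : (1 : ℤ) ≤ A c y := by exact_mod_cast hpos
        linarith
      · rw [gr' y h.le, if_neg h.ne', add_zero]; exact h1
    · rw [hBo x hxc hxc', go x y hxc hxc']; exact h1
  · intro x y
    have h2 := g2 x y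
    rcases eq_or_ne x c with rfl | hxc
    · rw [gl, hBr]
      rcases lt_or_ge y p with h | h
      · rw [gr y h, if_neg h.ne]
        have := key y h
        exact le_min (by linarith) (by linarith)
      · rw [gr' y h]; linarith
    rcases eq_or_ne (x + 1) c with rfl | hxc'
    · rw [gl, hBl]
      have := gle x y
      linarith
    · rw [go (x + 1) y hxc' (by omega), hBo (x + 1) hxc' (by omega)]
      exact (add_le_add_left (gle x y) _).trans h2
  · intro x y
    have h3 := g3 x y
    rcases eq_or_ne x c with rfl | hxc
    · rw [gl, gl, hBl]
      have : (0 : ℤ) ≤ if y = p then 1 else 0 := by split_ifs <;> norm_num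
      linarith
    rcases eq_or_ne x (c + 1) with rfl | hxc'
    · rw [hBr]
      rcases lt_trichotomy (y + 1) p with h | rfl | h
      · rw [gr _ h, gr y (by omega), if_neg h.ne, add_zero]
        have h4 := sum_Icc_eq_head_add (A (c + 1)) h.le
        rw [h4]
        refine le_min ?_ ?_
        · exact le_trans (add_le_add_left (min_le_left _ _) _) h3
        · refine le_trans (add_le_add_left (min_le_right _ _) _) ?_
          push_cast
          linarith
      · rw [gr' _ le_rfl, gr y (Nat.lt_succ_self y), if_pos rfl, Finset.Icc_self,
          Finset.sum_singleton]
        refine le_trans (add_le_add_left (min_le_right _ _) _) ?_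
        linarith
      · rw [gr' _ h.le, gr' y (Nat.le_of_lt_succ h), if_neg h.ne', add_zero]
        exact h3
    · rw [go x y hxc hxc', go x (y + 1) hxc hxc', hBo x hxc hxc']
      exact h3

/-! ### The operators on two adjacent columns -/

/-- Move a unit from column `c + 1` to column `c` at the last maximizing row, as long as column
`c` is not a maximal path itself. The operators `f_c` for `c < i` and, on the transposed pattern,
`e_{c+1}` for `c ≥ i` are of this form. -/
def colDown (a b c : ℕ) (A : Pattern) : Option Pattern :=
  if pathMax a b (A c) (A (c + 1)) - ∑ j ∈ Finset.Icc a b, A c j = 0 then none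
  else some (moveLeft c (maxOr 0 (argmaxSet a b (pathSum a b (A c) (A (c + 1))))) A)

/-- Move a unit from column `c` to column `c + 1` at the first maximizing row, as long as column
`c + 1` is not a maximal path itself. The operators `e_c` for `c < i` and, on the transposed
pattern, `f_{c+1}` for `c ≥ i` are of this form. -/
def colUp (a b c : ℕ) (A : Pattern) : Option Pattern :=
  if pathMax a b (A c) (A (c + 1)) - ∑ j ∈ Finset.Icc a b, A (c + 1) j = 0 then none
  else some (moveRight c (minOr 0 (argmaxSet a b (pathSum a b (A c) (A (c + 1))))) A)

theorem colDown_eq_some_iff {a b c : ℕ} (hab : a ≤ b) {A B : Pattern} :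
    colDown a b c A = some B ↔ ∑ j ∈ Finset.Icc a b, A c j < pathMax a b (A c) (A (c + 1)) ∧
      ∃ p, IsLastArg a b (pathSum a b (A c) (A (c + 1))) p ∧ B = moveLeft c p A := by
  have hp := isLastArg_maxOr hab (pathSum a b (A c) (A (c + 1)))
  unfold colDown
  split_ifs with h
  · simp only [false_iff, not_and]
    intro h'
    omega
  · rw [Option.some_inj]
    constructor
    · rintro rfl
      exact ⟨by omega, _, hp, rfl⟩
    · rintro ⟨-, q, hq, rfl⟩
      rw [hp.unique hq]

theorem colUp_eq_some_iff {a b c : ℕ} (hab : a ≤ b) {A B : Pattern} :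
    colUp a b c A = some B ↔ ∑ j ∈ Finset.Icc a b, A (c + 1) j < pathMax a b (A c) (A (c + 1)) ∧
      ∃ p, IsFirstArg a b (pathSum a b (A c) (A (c + 1))) p ∧ B = moveRight c p A := by
  have hp := isFirstArg_minOr hab (pathSum a b (A c) (A (c + 1)))
  unfold colUp
  split_ifs with h
  · simp only [false_iff, not_and]
    intro h'
    omega
  · rw [Option.some_inj]
    constructor
    · rintro rfl
      exact ⟨by omega, _, hp, rfl⟩
    · rintro ⟨-, q, hq, rfl⟩
      rw [hp.unique hq]

/-- What one step of `colDown` does to the two columns involved. -/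
theorem colDown_spec {a b c : ℕ} (hab : a ≤ b) {A B : Pattern} (h : colDown a b c A = some B) :
    ∑ j ∈ Finset.Icc a b, A c j < pathMax a b (A c) (A (c + 1)) ∧
      ∑ j ∈ Finset.Icc a b, B c j = ∑ j ∈ Finset.Icc a b, A c j + 1 ∧
      (∀ r, a ≤ r → pathMax r b (B c) (B (c + 1)) = pathMax r b (A c) (A (c + 1))) ∧
      (∀ j, B c j + B (c + 1) j = A c j + A (c + 1) j) ∧
      (∀ d, d ≠ c → d ≠ c + 1 → B d = A d) ∧ colUp a b c B = some A := by
  obtain ⟨hlt, p, hp, rfl⟩ := (colDown_eq_some_iff hab).mp h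
  have hpos := hp.pos hlt
  have hs := sum_bump (A c) p a b
  have hd := sum_drop hpos a b
  have hmem : a ≤ p ∧ p ≤ b := ⟨hp.left, hp.right⟩
  rw [if_pos hmem] at hs hd
  refine ⟨hlt, ?_, fun r har => ?_, fun j => ?_, fun d => moveLeft_of_ne A,
    (colUp_eq_some_iff hab).mpr ⟨?_, p, ?_, (moveRight_moveLeft hpos).symm⟩⟩
  · rw [moveLeft_left, hs]
  · rw [moveLeft_left, moveLeft_right, hp.pathMax_tail_bump_drop hpos har]
  · rw [moveLeft_left, moveLeft_right, bump, drop, Function.update_apply, Function.update_apply]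
    split_ifs with hj
    · subst hj; omega
    · rfl
  · rw [moveLeft_left, moveLeft_right, hp.pathMax_bump_drop hpos]
    have := sum_le_pathMax_right (A c) (A (c + 1)) hab
    omega
  · rw [moveLeft_left, moveLeft_right]
    exact hp.isFirstArg_bump_drop hpos

/-- What one step of `colUp` does to the two columns involved. -/
theorem colUp_spec {a b c : ℕ} (hab : a ≤ b) {A B : Pattern} (h : colUp a b c A = some B) :
    ∑ j ∈ Finset.Icc a b, A (c + 1) j < pathMax a b (A c) (A (c + 1)) ∧
      ∑ j ∈ Finset.Icc a b, B (c + 1) j = ∑ j ∈ Finset.Icc a b, A (c + 1) j + 1 ∧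
      pathMax a b (B c) (B (c + 1)) = pathMax a b (A c) (A (c + 1)) ∧
      colDown a b c B = some A := by
  obtain ⟨hlt, p, hp, rfl⟩ := (colUp_eq_some_iff hab).mp h
  have hpos := hp.pos hlt
  have hs := sum_drop hpos a b
  have hd := sum_bump (A (c + 1)) p a b
  have hmem : a ≤ p ∧ p ≤ b := ⟨hp.left, hp.right⟩
  rw [if_pos hmem] at hs hd
  refine ⟨hlt, ?_, ?_, (colDown_eq_some_iff hab).mpr ⟨?_, p, ?_, (moveLeft_moveRight hpos).symm⟩⟩
  · rw [moveRight_right, hd]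
  · rw [moveRight_left, moveRight_right, hp.pathMax_drop_bump hpos]
  · rw [moveRight_left, moveRight_right, hp.pathMax_drop_bump hpos]
    have := sum_le_pathMax_left (A c) (A (c + 1)) hab
    omega
  · rw [moveRight_left, moveRight_right]
    exact hp.isLastArg_drop_bump hpos

/-- The patterns with support in the columns `a₁, …, b₁` and the rows `a₂, …, b₂` and with path
sums at most `m`. -/
def boxPolytope (a₁ b₁ a₂ b₂ m : ℕ) : Set Pattern :=
  {A | (∀ p q, ¬ (a₁ ≤ p ∧ p ≤ b₁ ∧ a₂ ≤ q ∧ q ≤ b₂) → A p q = 0) ∧ HasPotential b₁ b₂ m A}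

theorem polytope_eq_boxPolytope {n i m : ℕ} (hi : 1 ≤ i) (hin : i ≤ n) :
    polytope n i m = boxPolytope 1 i i n m :=
  Set.ext fun _ => mem_polytope_iff hi hin

theorem transpose_mem_boxPolytope {a₁ b₁ a₂ b₂ m : ℕ} {A : Pattern}
    (hA : A ∈ boxPolytope a₁ b₁ a₂ b₂ m) : transpose A ∈ boxPolytope a₂ b₂ a₁ b₁ m :=
  ⟨fun p q h => hA.1 q p (by tauto), hA.2.transpose⟩

section BoxPolytope

variable {a₁ b₁ a₂ b₂ m c : ℕ}

theorem colDown_mem (hc : a₁ ≤ c) (hc' : c + 1 ≤ b₁) (hab : a₂ ≤ b₂) {A B : Pattern}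
    (hA : A ∈ boxPolytope a₁ b₁ a₂ b₂ m) (h : colDown a₂ b₂ c A = some B) :
    B ∈ boxPolytope a₁ b₁ a₂ b₂ m := by
  obtain ⟨hlt, p, hp, rfl⟩ := (colDown_eq_some_iff hab).mp h
  have h1 := hp.left
  have h2 := hp.right
  refine ⟨fun x y hxy => ?_, hA.2.moveLeft hc' (fun q hq => hA.1 c q (by omega))
    (fun q hq => hA.1 (c + 1) q (by omega)) hp hlt⟩
  have hx : ∀ d, (a₁ ≤ d ∧ d ≤ b₁) → ¬ (x = d ∧ y = p) := by
    rintro d hd ⟨rfl, rfl⟩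
    exact hxy ⟨hd.1, hd.2, h1, h2⟩
  have hx1 := hx c (by omega)
  have hx2 := hx (c + 1) (by omega)
  simp only [moveLeft, dec, inc, setEntry, hx1, hx2, if_false]
  exact hA.1 x y hxy

theorem colUp_mem (hc : a₁ ≤ c) (hc' : c + 1 ≤ b₁) (hab : a₂ ≤ b₂) {A B : Pattern}
    (hA : A ∈ boxPolytope a₁ b₁ a₂ b₂ m) (h : colUp a₂ b₂ c A = some B) :
    B ∈ boxPolytope a₁ b₁ a₂ b₂ m := by
  obtain ⟨hlt, p, hp, rfl⟩ := (colUp_eq_some_iff hab).mp h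
  have h1 := hp.left
  have h2 := hp.right
  refine ⟨fun x y hxy => ?_, hA.2.moveRight (fun q hq => hA.1 c q (by omega))
    (fun q hq => hA.1 (c + 1) q (by omega)) hp hlt⟩
  have hx : ∀ d, (a₁ ≤ d ∧ d ≤ b₁) → ¬ (x = d ∧ y = p) := by
    rintro d hd ⟨rfl, rfl⟩
    exact hxy ⟨hd.1, hd.2, h1, h2⟩
  have hx1 := hx c (by omega)
  have hx2 := hx (c + 1) (by omega)
  simp only [moveRight, dec, inc, setEntry, hx1, hx2, if_false]
  exact hA.1 x y hxy

theorem isStringOp_colDown (hc : a₁ ≤ c) (hc' : c + 1 ≤ b₁) (hab : a₂ ≤ b₂) :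
    IsStringOp (boxPolytope a₁ b₁ a₂ b₂ m) (colDown a₂ b₂ c)
      (fun A => pathMax a₂ b₂ (A c) (A (c + 1)) - ∑ j ∈ Finset.Icc a₂ b₂, A c j) where
  none_iff A _ := by simp [colDown]
  mem A hA B h := colDown_mem hc hc' hab hA h
  len_eq A _ B h := by
    obtain ⟨h1, h2, h3, -⟩ := colDown_spec hab h
    have := h3 a₂ le_rfl
    omega

theorem isStringOp_colUp (hc : a₁ ≤ c) (hc' : c + 1 ≤ b₁) (hab : a₂ ≤ b₂) :
    IsStringOp (boxPolytope a₁ b₁ a₂ b₂ m) (colUp a₂ b₂ c)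
      (fun A => pathMax a₂ b₂ (A c) (A (c + 1)) - ∑ j ∈ Finset.Icc a₂ b₂, A (c + 1) j) where
  none_iff A _ := by simp [colUp]
  mem A hA B h := colUp_mem hc hc' hab hA h
  len_eq A _ B h := by
    obtain ⟨h1, h2, h3, -⟩ := colUp_spec hab h
    omega

end BoxPolytope

/-- The result of applying `colDown` as often as possible: the sums over the final segments of the
new column `c` are the maximal path sums over these segments in the old columns. -/
theorem opPow_colDown_spec {a b c k : ℕ} (hab : a ≤ b) {A B : Pattern}
    (h : opPow (colDown a b c) k A = some B) :
    (∀ r, a ≤ r → pathMax r b (B c) (B (c + 1)) = pathMax r b (A c) (A (c + 1))) ∧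
      (∀ j, B c j + B (c + 1) j = A c j + A (c + 1) j) ∧
      (∀ d, d ≠ c → d ≠ c + 1 → B d = A d) := by
  induction k generalizing B with
  | zero => cases h; exact ⟨fun _ _ => rfl, fun _ => rfl, fun _ _ _ => rfl⟩
  | succ k ih =>
    rw [opPow_succ_last, Option.bind_eq_some_iff] at h
    obtain ⟨D, hD, hDB⟩ := h
    obtain ⟨h1, h2, h3⟩ := ih hD
    obtain ⟨-, -, h4, h5, h6, -⟩ := colDown_spec hab hDB
    exact ⟨fun r hr => (h4 r hr).trans (h1 r hr), fun j => (h5 j).trans (h2 j),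
      fun d hd hd' => (h6 d hd hd').trans (h3 d hd hd')⟩

/-! ### The polytope crystal is seminormal -/

section Formulas

variable {n i m ℓ : ℕ} {A : Pattern}

theorem polyPhi_of_lt (hℓ : 1 ≤ ℓ) (hℓi : ℓ < i) (hin : i ≤ n) :
    polyPhi n i m ℓ A
      = pathMax i n (A ℓ) (A (ℓ + 1)) - ∑ j ∈ Finset.Icc i n, A ℓ j := by
  have hp : IsLastArg i n (pathSum i n (A ℓ) (A (ℓ + 1))) (pMinus n i ℓ A) := isLastArg_maxOr hin _
  have h1 := hp.left
  have h2 := hp.right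
  rw [polyPhi, if_neg (by omega), if_neg (by omega), if_neg (by omega), hp.pathMax_eq, pathSum,
    sum_Icc_eq_add_sum_Icc (A ℓ) (show i ≤ pMinus n i ℓ A + 1 by omega) h2]
  omega

theorem polyEps_of_lt (hℓ : 1 ≤ ℓ) (hℓi : ℓ < i) (hin : i ≤ n) :
    polyEps n i m ℓ A
      = pathMax i n (A ℓ) (A (ℓ + 1)) - ∑ j ∈ Finset.Icc i n, A (ℓ + 1) j := by
  have hp : IsFirstArg i n (pathSum i n (A ℓ) (A (ℓ + 1))) (qMinus n i ℓ A) :=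
    isFirstArg_minOr hin _
  have h1 := hp.left
  have h2 := hp.right
  have h3 : qMinus n i ℓ A - 1 + 1 = qMinus n i ℓ A := by omega
  have h4 := sum_Icc_eq_add_sum_Icc (A (ℓ + 1)) (a := i) (c := qMinus n i ℓ A - 1) (b := n)
    (by omega) (by omega)
  rw [h3] at h4
  rw [polyEps, if_neg (by omega), if_neg (by omega), if_neg (by omega), hp.pathMax_eq, pathSum, h4]
  omega

theorem polyPhi_of_gt (hi : 1 ≤ i) (hℓ : i ≤ ℓ) :
    polyPhi n i m (ℓ + 1) A
      = pathMax 1 i (transpose A ℓ) (transpose A (ℓ + 1))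
        - ∑ j ∈ Finset.Icc 1 i, transpose A (ℓ + 1) j := by
  have hp : IsFirstArg 1 i (pathSum 1 i (transpose A ℓ) (transpose A (ℓ + 1)))
    (pPlus i (ℓ + 1) A) := isFirstArg_minOr hi _
  have h1 := hp.left
  have h2 := hp.right
  set p := pPlus i (ℓ + 1) A with hpdef
  have h3 : p - 1 + 1 = p := by omega
  have h4 := sum_Icc_eq_add_sum_Icc (transpose A (ℓ + 1)) (a := 1) (c := p - 1) (b := i)
    (by omega) (by omega)
  rw [h3] at h4
  rw [polyPhi, if_neg (by omega), if_neg (by omega), if_pos (by omega), hp.pathMax_eq, pathSum, h4,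
    ← hpdef, Nat.add_sub_cancel]
  simp only [transpose]
  omega

theorem polyEps_of_gt (hi : 1 ≤ i) (hℓ : i ≤ ℓ) :
    polyEps n i m (ℓ + 1) A
      = pathMax 1 i (transpose A ℓ) (transpose A (ℓ + 1))
        - ∑ j ∈ Finset.Icc 1 i, transpose A ℓ j := by
  have hp : IsLastArg 1 i (pathSum 1 i (transpose A ℓ) (transpose A (ℓ + 1)))
    (qPlus i (ℓ + 1) A) := isLastArg_maxOr hi _
  have h1 := hp.left
  have h2 := hp.right
  set p := qPlus i (ℓ + 1) A with hpdef
  have h4 := sum_Icc_eq_add_sum_Icc (transpose A ℓ) (a := 1) (c := p) (b := i) (by omega) h2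
  rw [polyEps, if_neg (by omega), if_neg (by omega), if_pos (by omega), hp.pathMax_eq, pathSum, h4,
    ← hpdef, Nat.add_sub_cancel]
  simp only [transpose]
  omega

theorem polyF_of_lt (hℓ : 1 ≤ ℓ) (hℓi : ℓ < i) (hin : i ≤ n) :
    polyF n i m ℓ A = colDown i n ℓ A := by
  rw [polyF, polyPhi_of_lt hℓ hℓi hin, if_neg (by omega : ¬ ℓ = 0), if_neg (by omega : ¬ ℓ = i),
    if_neg (by omega : ¬ i < ℓ)]
  rfl

theorem polyE_of_lt (hℓ : 1 ≤ ℓ) (hℓi : ℓ < i) (hin : i ≤ n) :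
    polyE n i m ℓ A = colUp i n ℓ A := by
  rw [polyE, polyEps_of_lt hℓ hℓi hin, if_neg (by omega : ¬ ℓ = 0), if_neg (by omega : ¬ ℓ = i),
    if_neg (by omega : ¬ i < ℓ)]
  rfl

theorem setEntry_transpose (A : Pattern) (p q v : ℕ) :
    setEntry (transpose A) p q v = transpose (setEntry A q p v) := by
  funext x y
  simp only [setEntry, transpose, and_comm]

theorem polyF_of_gt (hi : 1 ≤ i) (hℓ : i ≤ ℓ) :
    polyF n i m (ℓ + 1) A = (colUp 1 i ℓ (transpose A)).map transpose := by
  rw [polyF, polyPhi_of_gt hi hℓ, if_neg (by omega : ¬ ℓ + 1 = 0), if_neg (by omega : ¬ ℓ + 1 = i),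
    if_pos (by omega : i < ℓ + 1), colUp]
  split_ifs
  · rfl
  · simp only [moveRight, inc, dec, setEntry_transpose]
    rfl

theorem polyE_of_gt (hi : 1 ≤ i) (hℓ : i ≤ ℓ) :
    polyE n i m (ℓ + 1) A = (colDown 1 i ℓ (transpose A)).map transpose := by
  rw [polyE, polyEps_of_gt hi hℓ, if_neg (by omega : ¬ ℓ + 1 = 0), if_neg (by omega : ¬ ℓ + 1 = i),
    if_pos (by omega : i < ℓ + 1), colDown]
  split_ifs
  · rfl
  · simp only [moveLeft, inc, dec, setEntry_transpose]
    rfl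

theorem polyPhi_self (hi : 1 ≤ i) : polyPhi n i m i A
    = m - ∑ j ∈ Finset.Icc 1 (i - 1), A j i - ∑ j ∈ Finset.Icc i n, A i j := by
  rw [polyPhi, if_neg (by omega), if_pos rfl]

theorem polyEps_self (hi : 1 ≤ i) : polyEps n i m i A = A i i := by
  rw [polyEps, if_neg (by omega), if_pos rfl]

theorem polyF_eq_some_self (hi : 1 ≤ i) {B : Pattern} :
    polyF n i m i A = some B ↔ 0 < polyPhi n i m i A ∧ B = inc A i i := by
  rw [polyF, if_neg (by omega : ¬ i = 0), if_pos rfl]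
  split_ifs with h
  · simp [h]
  · simp [Nat.pos_of_ne_zero h, eq_comm]

theorem polyE_eq_some_self (hi : 1 ≤ i) {B : Pattern} :
    polyE n i m i A = some B ↔ 0 < A i i ∧ B = dec A i i := by
  rw [polyE, if_neg (by omega : ¬ i = 0), if_pos rfl, polyEps_self hi]
  split_ifs with h
  · simp [h]
  · simp [Nat.pos_of_ne_zero h, eq_comm]

end Formulas

theorem inc_col (A : Pattern) (p q : ℕ) : inc A p q p = bump (A p) q := by
  funext y
  by_cases h : y = q <;> simp [inc, setEntry, h]

theorem transpose_inc (A : Pattern) (p q : ℕ) :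
    transpose (inc A p q) = inc (transpose A) q p := by
  funext x y
  simp only [inc, setEntry, transpose, and_comm]

theorem inc_of_ne (A : Pattern) {p q x y : ℕ} (h : ¬ (x = p ∧ y = q)) : inc A p q x y = A x y :=
  if_neg h

/-- Raising the entry in the corner `(i, i)` preserves the path bound if `φ_i > 0`: there is only
one Dyck path through this corner. -/
theorem HasPotential.inc_corner {n i m : ℕ} (hi : 1 ≤ i) (hin : i ≤ n) {A : Pattern}
    (hA : A ∈ boxPolytope 1 i i n m)
    (hlt : ∑ j ∈ Finset.Icc 1 (i - 1), A j i + ∑ j ∈ Finset.Icc i n, A i j < m) :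
    HasPotential i n m (inc A i i) := by
  obtain ⟨hsupp, g, g1, g2, g3, g4⟩ := hA
  set B := inc A i i with hB
  have hBA : ∀ p q, q ≠ i → B p q = A p q := fun p q h => inc_of_ne A fun h' => h h'.2
  have hrow : ∀ p, ∑ j ∈ Finset.Icc 1 p, B j i
      = ∑ j ∈ Finset.Icc 1 p, A j i + if i ≤ p then 1 else 0 := by
    intro p
    have h1 := sum_bump (KR.transpose A i) i 1 p
    rw [← inc_col, ← transpose_inc] at h1
    simp only [hi, true_and] at h1
    exact h1
  have hrow_le : ∀ p, ((∑ j ∈ Finset.Icc 1 p, A j i : ℕ) : ℤ) ≤ g p i := by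
    intro p
    have h1 := potential_add_sum_le (A := KR.transpose A) (g := fun x y => g y x) (x := i)
      (fun q => g2 q i) (Nat.zero_le p)
    have h2 : (0 : ℤ) ≤ g 0 i := le_trans (Int.natCast_nonneg _) (g1 0 i)
    simp only [KR.transpose, zero_add] at h1
    linarith
  have hcol_le : ∀ q, i ≤ q → ((∑ j ∈ Finset.Icc 1 i, A j i : ℕ) : ℤ)
      + ((∑ j ∈ Finset.Icc (i + 1) q, A i j : ℕ) : ℤ) ≤ g i q := by
    intro q hq
    have := potential_add_sum_le (g3 i) hq
    have := hrow_le i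
    linarith
  have hentry : ∀ p, (B p i : ℤ) ≤ ((∑ j ∈ Finset.Icc 1 p, B j i : ℕ) : ℤ) := by
    intro p
    rcases Nat.eq_zero_or_pos p with rfl | hp
    · rw [hB, inc_of_ne A (by omega), hsupp 0 i (by omega)]
      exact Int.natCast_nonneg _
    · exact_mod_cast Finset.single_le_sum (f := fun j => B j i) (fun _ _ => Nat.zero_le _)
        (Finset.mem_Icc.mpr ⟨hp, le_rfl⟩)
  have hcorner : ∑ j ∈ Finset.Icc 1 i, A j i + ∑ j ∈ Finset.Icc (i + 1) n, A i j + 1 ≤ m := by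
    obtain ⟨i, rfl⟩ : ∃ i', i = i' + 1 := ⟨i - 1, by omega⟩
    rw [sum_Icc_add_one _ (by omega)]
    rw [sum_Icc_eq_head_add _ hin, Nat.add_sub_cancel] at hlt
    omega
  refine ⟨fun p q => if q < i then 0 else if q = i then ((∑ j ∈ Finset.Icc 1 p, B j i : ℕ) : ℤ)
    else if p < i then g p q else if p = i then max (g i q) (((∑ j ∈ Finset.Icc 1 i, B j i : ℕ) : ℤ)
      + ((∑ j ∈ Finset.Icc (i + 1) q, A i j : ℕ) : ℤ)) else g p q + 1, ?_, ?_, ?_, ?_⟩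
  · intro p q
    rcases lt_trichotomy q i with h | rfl | h
    · simp only [h, if_true]
      rw [hBA p q h.ne, hsupp p q (by omega)]; rfl
    · simpa only [lt_irrefl, if_true, if_false] using hentry p
    · simp only [not_lt.mpr h.le, h.ne', if_false]
      rw [hBA p q h.ne']
      have := g1 p q
      split_ifs with h1 h2
      · exact this
      · subst h2; exact this.trans (le_max_left _ _)
      · linarith
  · intro p q
    rcases lt_trichotomy q i with h | rfl | h
    · simp only [h, if_true]
      rw [hBA _ q h.ne, hsupp _ q (by omega)]; rfl
    · simp only [lt_irrefl, if_true, if_false]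
      rw [sum_Icc_add_one _ (by omega)]
      push_cast
      rfl
    · simp only [not_lt.mpr h.le, h.ne', if_false]
      rw [hBA _ q h.ne']
      have h2 := g2 p q
      rcases lt_trichotomy (p + 1) i with h' | h' | h'
      · simpa only [h', (Nat.lt_succ_self p).trans h', if_true] using h2
      · subst h'
        simp only [lt_irrefl, if_false, if_true, Nat.lt_succ_self]
        exact h2.trans (le_max_left _ _)
      · rcases (Nat.le_of_lt_succ h').eq_or_lt with h'' | h''
        · subst h''
          simp only [lt_irrefl, if_false, if_true, not_lt.mpr (Nat.le_succ i),
            Nat.succ_ne_self]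
          have h3 := hcol_le q h.le
          have h4 := hrow i
          rw [if_pos le_rfl] at h4
          rw [h4]
          rw [← sub_nonneg, ← sub_sub, sub_sub, sub_nonneg, ← le_sub_iff_add_le]
          exact max_le (by linarith) (by push_cast at h3 ⊢; linarith)
        · simp only [not_lt.mpr h'.le, not_lt.mpr h''.le, h''.ne', h'.ne', if_false]
          linarith
  · intro p q
    rcases lt_trichotomy (q + 1) i with h | rfl | h
    · simp only [h, (Nat.lt_succ_self q).trans h, if_true]
      rw [hBA p _ h.ne, hsupp p _ (by omega)]; rfl
    · simp only [lt_irrefl, Nat.lt_succ_self, if_true, if_false, zero_add]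
      exact hentry p
    · have h3 := g3 p q
      rcases (Nat.le_of_lt_succ h).eq_or_lt with rfl | h'
      · simp only [lt_irrefl, if_true, if_false, not_lt.mpr (Nat.le_succ i), Nat.succ_ne_self]
        rw [hBA p _ (Nat.succ_ne_self i), hrow p]
        have h4 := hrow_le p
        rcases lt_trichotomy p i with h5 | rfl | h5
        · simp only [h5, not_le.mpr h5, if_true, if_false, add_zero]
          exact (add_le_add_left h4 _).trans h3
        · simp only [lt_irrefl, if_true, if_false, le_refl]
          refine le_trans ?_ (le_max_right _ _)
          rw [hrow p, Finset.Icc_self, Finset.sum_singleton, if_pos le_rfl]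
        · simp only [h5.le, not_lt.mpr h5.le, h5.ne', if_true, if_false]
          push_cast at h4 ⊢
          linarith
      · simp only [not_lt.mpr h.le, not_lt.mpr h'.le, h.ne', h'.ne', if_false]
        rw [hBA p _ h.ne']
        rcases lt_trichotomy p i with h5 | rfl | h5
        · simpa only [h5, if_true] using h3
        · simp only [lt_irrefl, if_true, if_false]
          rw [sum_Icc_add_one _ (by omega), ← le_sub_iff_add_le]
          refine max_le ?_ ?_
          · exact le_sub_iff_add_le.mpr (h3.trans (le_max_left _ _))
          · rw [le_sub_iff_add_le]
            refine le_trans (le_of_eq ?_) (le_max_right _ _)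
            push_cast
            ring
        · simp only [not_lt.mpr h5.le, h5.ne', if_false]
          linarith
  · rcases hin.eq_or_lt with rfl | h
    · simp only [lt_irrefl, if_true, if_false]
      rw [hrow, if_pos le_rfl]
      have : ∑ j ∈ Finset.Icc (i + 1) i, A i j = 0 := by simp
      exact_mod_cast (by omega : _ ≤ m)
    · simp only [lt_irrefl, if_true, if_false, not_lt.mpr h.le, h.ne']
      rw [hrow, if_pos le_rfl]
      refine max_le g4 ?_
      exact_mod_cast (by omega : _ ≤ m)

theorem dec_inc (A : Pattern) (p q : ℕ) : dec (inc A p q) p q = A := by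
  funext x y
  by_cases h : x = p ∧ y = q
  · simp [dec, inc, setEntry, h]
  · simp [dec, inc, setEntry, h]

theorem inc_dec {A : Pattern} {p q : ℕ} (hA : 0 < A p q) : inc (dec A p q) p q = A := by
  funext x y
  by_cases h : x = p ∧ y = q
  · simp [dec, inc, setEntry, h, Nat.sub_add_cancel hA]
  · simp [dec, inc, setEntry, h]

theorem polyPhi_inc_corner {n i m : ℕ} (hi : 1 ≤ i) (hin : i ≤ n) (A : Pattern) :
    polyPhi n i m i (inc A i i) = polyPhi n i m i A - 1 := by
  have h1 : ∑ j ∈ Finset.Icc i n, inc A i i i j = ∑ j ∈ Finset.Icc i n, A i j + 1 := by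
    rw [inc_col, sum_bump, if_pos ⟨le_rfl, hin⟩]
  have h2 : ∑ j ∈ Finset.Icc 1 (i - 1), inc A i i j i = ∑ j ∈ Finset.Icc 1 (i - 1), A j i :=
    Finset.sum_congr rfl fun j hj => inc_of_ne A (by have := Finset.mem_Icc.mp hj; omega)
  rw [polyPhi_self hi, polyPhi_self hi, h1, h2]
  omega

/-- The sum along the row `i` up to column `s`, then up the column `s` to row `p`, and then up the
column `s + 1`, is part of a path sum. -/
theorem row_add_pathSum_le {n i m s p : ℕ} {A : Pattern} (hA : A ∈ boxPolytope 1 i i n m)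
    (hs : s + 1 ≤ i) (hp : i ≤ p) (hpn : p ≤ n) :
    ∑ j ∈ Finset.Icc 1 (s - 1), A j i + pathSum i n (A s) (A (s + 1)) p ≤ m := by
  obtain ⟨hsupp, g, g1, g2, g3, g4⟩ := hA
  have h1 := potential_add_sum_le (A := transpose A) (g := fun x y => g y x) (x := i)
    (fun q => g2 q i) (Nat.zero_le s)
  have h2 := potential_add_sum_le (g3 s) hp
  have h3 := g2 s p
  have h4 := potential_add_sum_le (g3 (s + 1)) hpn
  have h5 := potential_add_sum_le (A := transpose A) (g := fun x y => g y x) (x := n)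
    (fun q => g2 q n) hs
  have h6 : (0 : ℤ) ≤ g 0 i := le_trans (Int.natCast_nonneg _) (g1 0 i)
  have h7 : (∑ j ∈ Finset.Icc 1 (s - 1), A j i) + A s i = ∑ j ∈ Finset.Icc 1 s, A j i := by
    rcases Nat.eq_zero_or_pos s with rfl | h
    · simp [hsupp 0 i (by omega)]
    · obtain ⟨s, rfl⟩ : ∃ s', s = s' + 1 := ⟨s - 1, by omega⟩
      exact (sum_Icc_add_one (fun j => A j i) (by omega)).symm
  have h8 := sum_Icc_eq_head_add (A s) hp
  have h9 := sum_Icc_eq_head_add (A (s + 1)) hpn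
  have h10 : (0 : ℤ) ≤ ((∑ j ∈ Finset.Icc (s + 1 + 1) i, transpose A n j : ℕ) : ℤ) :=
    Int.natCast_nonneg _
  simp only [transpose, zero_add] at h1 h10 h5
  rw [← h7] at h1
  rw [pathSum, h8, h9]
  have : ((∑ j ∈ Finset.Icc 1 (s - 1), A j i : ℕ) : ℤ)
      + ((A s i : ℤ) + ((∑ j ∈ Finset.Icc (i + 1) p, A s j : ℕ) : ℤ)
        + (A (s + 1) p + ((∑ j ∈ Finset.Icc (p + 1) n, A (s + 1) j : ℕ) : ℤ))) ≤ m := by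
    push_cast at h1 h2 h4 h5 h10 ⊢
    linarith
  exact_mod_cast this

/-- The bound for the unique Dyck path through the corner `(i, i)`. -/
theorem row_add_col_le {n i m : ℕ} {A : Pattern} (hA : A ∈ boxPolytope 1 i i n m) (hi : 1 ≤ i)
    (hin : i ≤ n) :
    ∑ j ∈ Finset.Icc 1 (i - 1), A j i + ∑ j ∈ Finset.Icc i n, A i j ≤ m := by
  obtain ⟨hsupp, g, g1, g2, g3, g4⟩ := hA
  have hrow := potential_add_sum_le (A := transpose A) (g := fun x y => g y x) (x := i)
    (fun q => g2 q i) (Nat.zero_le i)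
  have hcol := potential_add_sum_le (g3 i) hin
  have h0 : (0 : ℤ) ≤ g 0 i := le_trans (Int.natCast_nonneg _) (g1 0 i)
  have h2 : ∑ j ∈ Finset.Icc 1 i, A j i = ∑ j ∈ Finset.Icc 1 (i - 1), A j i + A i i := by
    obtain ⟨i, rfl⟩ : ∃ i', i = i' + 1 := ⟨i - 1, by omega⟩
    exact sum_Icc_add_one (fun j => A j (i + 1)) (by omega)
  have h3 := sum_Icc_eq_head_add (A i) hin
  simp only [transpose, zero_add] at hrow
  rw [h2] at hrow
  have : ((∑ j ∈ Finset.Icc 1 (i - 1), A j i : ℕ) : ℤ)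
      + (A i i + ((∑ j ∈ Finset.Icc (i + 1) n, A i j : ℕ) : ℤ)) ≤ m := by
    push_cast at hrow hcol ⊢
    linarith
  rw [h3]
  exact_mod_cast this

/-- The polytope crystal is seminormal at every classical node. -/
theorem polytopeCrystal_isSeminormalAt {n i m ℓ : ℕ} (hi : 1 ≤ i) (hin : i ≤ n) (hℓ : 1 ≤ ℓ)
    (hℓn : ℓ ≤ n) : (polytopeCrystal n i m).IsSeminormalAt ℓ := by
  have hcar : (polytopeCrystal n i m).carrier = boxPolytope 1 i i n m :=
    polytope_eq_boxPolytope hi hin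
  rcases lt_trichotomy ℓ i with h | rfl | h
  · have hf : (polytopeCrystal n i m).f ℓ = colDown i n ℓ := funext fun A => polyF_of_lt hℓ h hin
    have he : (polytopeCrystal n i m).e ℓ = colUp i n ℓ := funext fun A => polyE_of_lt hℓ h hin
    have hphi : (polytopeCrystal n i m).phi ℓ = _ := funext fun A => polyPhi_of_lt hℓ h hin
    have heps : (polytopeCrystal n i m).eps ℓ = _ := funext fun A => polyEps_of_lt hℓ h hin
    constructor
    · rw [hcar, hf, hphi]; exact isStringOp_colDown hℓ h hin
    · rw [hcar, he, heps]; exact isStringOp_colUp hℓ h hin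
    · rw [hf, he]; exact fun A _ B hAB => (colDown_spec hin hAB).2.2.2.2.2
    · rw [hf, he]; exact fun A _ B hAB => (colUp_spec hin hAB).2.2.2
  · have hmem : ∀ A ∈ boxPolytope 1 ℓ ℓ n m, 0 < polyPhi n ℓ m ℓ A →
        inc A ℓ ℓ ∈ boxPolytope 1 ℓ ℓ n m := by
      intro A hA h
      refine ⟨fun p q hpq => ?_, HasPotential.inc_corner hℓ hin hA ?_⟩
      · rw [inc_of_ne A (by omega)]; exact hA.1 p q hpq
      · rw [polyPhi_self hℓ] at h; omega
    refine ⟨⟨fun A hA => ?_, fun A hA B h => ?_, fun A hA B h => ?_⟩,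
      ⟨fun A hA => ?_, fun A hA B h => ?_, fun A hA B h => ?_⟩, fun A hA B h => ?_,
      fun A hA B h => ?_⟩
    · change polyF n ℓ m ℓ A = none ↔ polyPhi n ℓ m ℓ A = 0
      rw [polyF, if_neg (by omega : ¬ ℓ = 0), if_pos rfl]
      split_ifs <;> simp [*]
    · obtain ⟨h1, rfl⟩ := (polyF_eq_some_self hℓ).mp h
      rw [hcar] at hA ⊢
      exact hmem A hA h1
    · obtain ⟨h1, rfl⟩ := (polyF_eq_some_self hℓ).mp h
      change polyPhi n ℓ m ℓ A = polyPhi n ℓ m ℓ (inc A ℓ ℓ) + 1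
      rw [polyPhi_inc_corner hℓ hin]
      omega
    · change polyE n ℓ m ℓ A = none ↔ polyEps n ℓ m ℓ A = 0
      rw [polyE, if_neg (by omega : ¬ ℓ = 0), if_pos rfl]
      split_ifs <;> simp [*]
    · obtain ⟨h1, rfl⟩ := (polyE_eq_some_self hℓ).mp h
      rw [hcar] at hA ⊢
      refine ⟨fun p q hpq => ?_, hA.2.mono fun p q => ?_⟩
      · rw [dec, setEntry, if_neg (by omega)]; exact hA.1 p q hpq
      · rw [dec, setEntry]
        split_ifs with hpq
        · rw [hpq.1, hpq.2]; exact Nat.sub_le _ _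
        · exact le_rfl
    · obtain ⟨h1, rfl⟩ := (polyE_eq_some_self hℓ).mp h
      change polyEps n ℓ m ℓ A = polyEps n ℓ m ℓ (dec A ℓ ℓ) + 1
      rw [polyEps_self hℓ, polyEps_self hℓ, dec, setEntry, if_pos ⟨rfl, rfl⟩]
      omega
    · obtain ⟨h1, rfl⟩ := (polyF_eq_some_self hℓ).mp h
      refine (polyE_eq_some_self hℓ).mpr ⟨?_, (dec_inc A ℓ ℓ).symm⟩
      rw [inc_col]; simp
    · obtain ⟨h1, rfl⟩ := (polyE_eq_some_self hℓ).mp h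
      refine (polyF_eq_some_self hℓ).mpr ⟨?_, (inc_dec h1).symm⟩
      rw [hcar] at hA
      have hle := row_add_col_le hA hi hin
      have h4 : ∑ j ∈ Finset.Icc 1 (ℓ - 1), dec A ℓ ℓ j ℓ = ∑ j ∈ Finset.Icc 1 (ℓ - 1), A j ℓ :=
        Finset.sum_congr rfl fun j hj => if_neg (by have := Finset.mem_Icc.mp hj; omega)
      have h5 : ∑ j ∈ Finset.Icc ℓ n, dec A ℓ ℓ ℓ j + 1 = ∑ j ∈ Finset.Icc ℓ n, A ℓ j := by
        have := sum_bump (dec A ℓ ℓ ℓ) ℓ ℓ n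
        rwa [← inc_col, inc_dec h1, if_pos ⟨le_rfl, hin⟩, eq_comm] at this
      rw [polyPhi_self hℓ, h4]
      omega
  · obtain ⟨ℓ, rfl⟩ : ∃ ℓ', ℓ = ℓ' + 1 := ⟨ℓ - 1, by omega⟩
    have hi' : i ≤ ℓ := by omega
    have hf : ∀ A B, (polytopeCrystal n i m).f (ℓ + 1) A = some B ↔
        colUp 1 i ℓ (transpose A) = some (transpose B) := by
      intro A B
      change polyF n i m (ℓ + 1) A = some B ↔ _
      rw [polyF_of_gt hi hi', Option.map_eq_some_iff]
      exact ⟨by rintro ⟨D, hD, rfl⟩; exact hD, fun h => ⟨_, h, rfl⟩⟩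
    have he : ∀ A B, (polytopeCrystal n i m).e (ℓ + 1) A = some B ↔
        colDown 1 i ℓ (transpose A) = some (transpose B) := by
      intro A B
      change polyE n i m (ℓ + 1) A = some B ↔ _
      rw [polyE_of_gt hi hi', Option.map_eq_some_iff]
      exact ⟨by rintro ⟨D, hD, rfl⟩; exact hD, fun h => ⟨_, h, rfl⟩⟩
    have hup := isStringOp_colUp (a₁ := i) (b₁ := n) (m := m) hi' hℓn hi
    have hdown := isStringOp_colDown (a₁ := i) (b₁ := n) (m := m) hi' hℓn hi
    have hphi : ∀ A, (polytopeCrystal n i m).phi (ℓ + 1) A = _ := fun A =>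
      polyPhi_of_gt (n := n) (m := m) hi hi'
    have heps : ∀ A, (polytopeCrystal n i m).eps (ℓ + 1) A = _ := fun A =>
      polyEps_of_gt (n := n) (m := m) hi hi'
    refine ⟨⟨fun A hA => ?_, fun A hA B h => ?_, fun A hA B h => ?_⟩,
      ⟨fun A hA => ?_, fun A hA B h => ?_, fun A hA B h => ?_⟩, fun A hA B h => ?_,
      fun A hA B h => ?_⟩
    · change polyF n i m (ℓ + 1) A = none ↔ _
      rw [hcar] at hA
      rw [polyF_of_gt hi hi', Option.map_eq_none_iff,
        hup.none_iff _ (transpose_mem_boxPolytope hA), hphi]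
    · rw [hcar] at hA ⊢
      exact transpose_mem_boxPolytope (hup.mem _ (transpose_mem_boxPolytope hA) _ ((hf A B).mp h))
    · rw [hcar] at hA
      rw [hphi, hphi]
      exact hup.len_eq _ (transpose_mem_boxPolytope hA) _ ((hf A B).mp h)
    · change polyE n i m (ℓ + 1) A = none ↔ _
      rw [hcar] at hA
      rw [polyE_of_gt hi hi', Option.map_eq_none_iff,
        hdown.none_iff _ (transpose_mem_boxPolytope hA), heps]
    · rw [hcar] at hA ⊢
      exact transpose_mem_boxPolytope
        (hdown.mem _ (transpose_mem_boxPolytope hA) _ ((he A B).mp h))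
    · rw [hcar] at hA
      rw [heps, heps]
      exact hdown.len_eq _ (transpose_mem_boxPolytope hA) _ ((he A B).mp h)
    · exact (he B A).mpr (colUp_spec hi ((hf A B).mp h)).2.2.2
    · exact (hf B A).mpr (colDown_spec hi ((he A B).mp h)).2.2.2.2.2

/-! ### Maximal strings in a seminormal crystal -/

section MaximalStrings

variable {X : Type} {C : Crystal X} {ℓ : ℕ}

namespace Crystal.IsSeminormalAt

theorem opPow_f_spec (h : C.IsSeminormalAt ℓ) {x y : X} (hx : x ∈ C.carrier) {k : ℕ}
    (hk : opPow (C.f ℓ) k x = some y) :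
    y ∈ C.carrier ∧ C.phi ℓ x = C.phi ℓ y + k ∧ C.eps ℓ y = C.eps ℓ x + k := by
  obtain ⟨h1, h2⟩ := h.f_string.opPow_spec hx hk
  exact ⟨h1, h2, (h.e_string.opPow_spec h1 (h.opPow_e_of_opPow_f hx hk)).2⟩

theorem fTop_zero_eq_some (h : C.IsSeminormalAt ℓ) {x y : X} (hx : x ∈ C.carrier) {k : ℕ}
    (hk : opPow (C.f ℓ) k x = some y) (hy : C.phi ℓ y = 0) : C.fTop ℓ 0 x = some y := by
  have := (h.opPow_f_spec hx hk).2.1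
  rw [Crystal.fTop, if_pos (Nat.zero_le _), this, hy, zero_add, Nat.sub_zero, hk]

theorem exists_fTop_zero (h : C.IsSeminormalAt ℓ) {x : X} (hx : x ∈ C.carrier) :
    ∃ y, C.fTop ℓ 0 x = some y := by
  obtain ⟨y, hy⟩ := h.f_string.exists_opPow hx le_rfl
  exact ⟨y, by rw [Crystal.fTop, if_pos (Nat.zero_le _), Nat.sub_zero, hy]⟩

theorem fTop_zero_spec (h : C.IsSeminormalAt ℓ) {x y : X} (hx : x ∈ C.carrier)
    (hxy : C.fTop ℓ 0 x = some y) :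
    opPow (C.f ℓ) (C.phi ℓ x) x = some y ∧ y ∈ C.carrier ∧ C.phi ℓ y = 0 := by
  rw [Crystal.fTop, if_pos (Nat.zero_le _), Nat.sub_zero] at hxy
  have := h.opPow_f_spec hx hxy
  exact ⟨hxy, this.1, by omega⟩

/-- If `y` is the end of the `f_ℓ`-string of `x`, then raising `y` as long as `ε_ℓ > ε_ℓ(x)`
leads back to `x`. -/
theorem eTop_of_fTop_zero (h : C.IsSeminormalAt ℓ) {x y : X} (hx : x ∈ C.carrier)
    (hxy : C.fTop ℓ 0 x = some y) : C.eTop ℓ (C.eps ℓ x) y = some x := by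
  have h1 := (h.fTop_zero_spec hx hxy).1
  have h2 := (h.opPow_f_spec hx h1).2.2
  rw [Crystal.eTop, if_pos (by omega), h2, Nat.add_sub_cancel_left]
  exact h.opPow_e_of_opPow_f hx h1

end Crystal.IsSeminormalAt

theorem exists_maximal_run {i : ℕ} (hC : ∀ ℓ, 1 ≤ ℓ → ℓ ≤ i → C.IsSeminormalAt ℓ) {x : X}
    (hx : x ∈ C.carrier) :
    ∃ Z : ℕ → X, Z i = x ∧ (∀ s ≤ i, Z s ∈ C.carrier) ∧
      ∀ s < i, C.fTop (s + 1) 0 (Z (s + 1)) = some (Z s) := by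
  induction i generalizing x with
  | zero => exact ⟨fun _ => x, rfl, fun _ _ => hx, fun s hs => absurd hs (Nat.not_lt_zero s)⟩
  | succ i ih =>
    have hsn := hC (i + 1) (by omega) le_rfl
    obtain ⟨y, hy⟩ := hsn.exists_fTop_zero hx
    obtain ⟨Z, h1, h2, h3⟩ := ih (fun ℓ h h' => hC ℓ h (by omega)) (hsn.fTop_zero_spec hx hy).2.1
    have hZ : ∀ s ≤ i, Function.update Z (i + 1) x s = Z s := fun s hs =>
      Function.update_of_ne (by omega) _ _
    refine ⟨Function.update Z (i + 1) x, Function.update_self .., fun s hs => ?_, fun s hs => ?_⟩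
    · rcases hs.eq_or_lt with rfl | hs
      · rwa [Function.update_self]
      · rw [hZ s (by omega)]; exact h2 s (by omega)
    · rw [hZ s (by omega)]
      rcases (Nat.le_of_lt_succ hs).eq_or_lt with rfl | hs
      · rw [Function.update_self, hy, h1]
      · rw [hZ (s + 1) (by omega)]; exact h3 s hs

end MaximalStrings

/-! ### Strings in the polytope crystal -/

theorem pathMax_zero_left {a b : ℕ} (hab : a ≤ b) {u w : ℕ → ℕ}
    (hu : ∀ j, a ≤ j → j ≤ b → u j = 0) : pathMax a b u w = ∑ j ∈ Finset.Icc a b, w j := by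
  refine le_antisymm (Finset.sup_le fun p hp => ?_) (sum_le_pathMax_right u w hab)
  obtain ⟨h1, h2⟩ := Finset.mem_Icc.mp hp
  have : ∑ j ∈ Finset.Icc a p, u j = 0 := Finset.sum_eq_zero fun j hj =>
    hu j (Finset.mem_Icc.mp hj).1 ((Finset.mem_Icc.mp hj).2.trans h2)
  rw [pathSum, this, zero_add]
  exact Finset.sum_le_sum_of_subset (Finset.Icc_subset_Icc_left h1)

theorem pathMax_congr {a b : ℕ} {u w u' w' : ℕ → ℕ} (hu : ∀ j, a ≤ j → j ≤ b → u j = u' j)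
    (hw : ∀ j, a ≤ j → j ≤ b → w j = w' j) : pathMax a b u w = pathMax a b u' w' := by
  refine Finset.sup_congr rfl fun p hp => ?_
  obtain ⟨h1, h2⟩ := Finset.mem_Icc.mp hp
  unfold pathSum
  congr 1
  · exact Finset.sum_congr rfl fun j hj =>
      hu j (Finset.mem_Icc.mp hj).1 ((Finset.mem_Icc.mp hj).2.trans h2)
  · exact Finset.sum_congr rfl fun j hj =>
      hw j (h1.trans (Finset.mem_Icc.mp hj).1) (Finset.mem_Icc.mp hj).2

theorem eq_of_tail_sums_eq {a b : ℕ} {u v : ℕ → ℕ}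
    (h : ∀ r, a ≤ r → r ≤ b → ∑ j ∈ Finset.Icc r b, u j = ∑ j ∈ Finset.Icc r b, v j) {r : ℕ}
    (har : a ≤ r) (hrb : r ≤ b) : u r = v r := by
  have h1 := h r har hrb
  rw [sum_Icc_eq_head_add u hrb, sum_Icc_eq_head_add v hrb] at h1
  rcases hrb.eq_or_lt with rfl | hlt
  · simpa using h1
  · have h2 := h (r + 1) (by omega) hlt
    omega

section PolytopeStrings

variable {n i m : ℕ}

theorem mem_carrier_iff (hi : 1 ≤ i) (hin : i ≤ n) {A : Pattern} :
    A ∈ (polytopeCrystal n i m).carrier ↔ A ∈ boxPolytope 1 i i n m := by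
  rw [← polytope_eq_boxPolytope hi hin]; rfl

/-- The end of an `f_s`-string, `1 ≤ s < i`. -/
theorem fTop_zero_spec_of_lt {s : ℕ} (hs : 1 ≤ s) (hsi : s < i) (hin : i ≤ n) {A B : Pattern}
    (hA : A ∈ (polytopeCrystal n i m).carrier)
    (h : (polytopeCrystal n i m).fTop s 0 A = some B) :
    (∀ r, i ≤ r → r ≤ n → ∑ j ∈ Finset.Icc r n, B s j = pathMax r n (A s) (A (s + 1))) ∧
      (∀ j, B s j + B (s + 1) j = A s j + A (s + 1) j) ∧
      (∀ d, d ≠ s → d ≠ s + 1 → B d = A d) := by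
  have hsn := polytopeCrystal_isSeminormalAt (m := m) (hs.trans hsi.le) hin hs (by omega)
  obtain ⟨h1, -, h3⟩ := hsn.fTop_zero_spec hA h
  have hf : (polytopeCrystal n i m).f s = colDown i n s := funext fun A => polyF_of_lt hs hsi hin
  rw [hf] at h1
  obtain ⟨h4, h5, h6⟩ := opPow_colDown_spec hin h1
  refine ⟨fun r hr hrn => ?_, h5, h6⟩
  have h7 : polyPhi n i m s B = 0 := h3
  rw [polyPhi_of_lt hs hsi hin] at h7
  have h8 := sum_le_pathMax_left (B s) (B (s + 1)) hin
  rw [← h4 r hr, pathMax_tail_eq_sum hr hrn (by omega)]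

theorem opPow_polyF_self (hi : 1 ≤ i) {A B : Pattern} {k : ℕ}
    (h : opPow (polyF n i m i) k A = some B) :
    B i i = A i i + k ∧ ∀ p q, ¬ (p = i ∧ q = i) → B p q = A p q := by
  induction k generalizing B with
  | zero => cases h; exact ⟨rfl, fun _ _ _ => rfl⟩
  | succ k ih =>
    rw [opPow_succ_last, Option.bind_eq_some_iff] at h
    obtain ⟨D, hD, hDB⟩ := h
    obtain ⟨-, rfl⟩ := (polyF_eq_some_self hi).mp hDB
    obtain ⟨h1, h2⟩ := ih hD
    refine ⟨?_, fun p q hpq => (inc_of_ne D hpq).trans (h2 p q hpq)⟩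
    rw [inc_col, bump, Function.update_self, h1, add_assoc]

/-- Powers of `e_s`, `1 ≤ s < i`, when the path turning at the very beginning is maximal: all
units are moved in row `i`. -/
theorem opPow_colUp_of_first {s k : ℕ} (hin : i ≤ n) {A B : Pattern}
    (hmax : pathMax i n (A s) (A (s + 1)) = pathSum i n (A s) (A (s + 1)) i)
    (h : opPow (colUp i n s) k A = some B) :
    B s i + k = A s i ∧ B (s + 1) i = A (s + 1) i + k ∧
      (∀ d r, (r = i → d ≠ s ∧ d ≠ s + 1) → B d r = A d r) ∧
      pathMax i n (B s) (B (s + 1)) = pathSum i n (B s) (B (s + 1)) i := by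
  induction k generalizing B with
  | zero => cases h; exact ⟨rfl, rfl, fun _ _ _ => rfl, hmax⟩
  | succ k ih =>
    rw [opPow_succ_last, Option.bind_eq_some_iff] at h
    obtain ⟨D, hD, hDB⟩ := h
    obtain ⟨h1, h2, h3, h4⟩ := ih hD
    obtain ⟨hlt, p, hp, rfl⟩ := (colUp_eq_some_iff hin).mp hDB
    have hfirst : IsFirstArg i n (pathSum i n (D s) (D (s + 1))) i :=
      ⟨le_rfl, hin, fun q hq hqn => h4 ▸ pathSum_le_pathMax _ _ hq hqn, fun q hq hqi => by omega⟩
    obtain rfl := hp.unique hfirst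
    have hpos := hp.pos hlt
    refine ⟨?_, ?_, fun d r hdr => ?_, ?_⟩
    · rw [moveRight_left, drop, Function.update_self]; omega
    · rw [moveRight_right, bump, Function.update_self]; omega
    · rw [← h3 d r hdr]
      rcases eq_or_ne d s with rfl | h5
      · rw [moveRight_left, drop, Function.update_of_ne]
        exact fun hr => (hdr hr).1 rfl
      rcases eq_or_ne d (s + 1) with rfl | h6
      · rw [moveRight_right, bump, Function.update_of_ne]
        exact fun hr => (hdr hr).2 rfl
      · rw [moveRight_of_ne _ h5 h6]
    · rw [moveRight_left, moveRight_right]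
      exact (hp.isLastArg_drop_bump hpos).pathMax_eq

end PolytopeStrings

/-! ### Moving a row through the empty rows below it -/

/-- The rows above row `k` of `A`, together with row `k` of `A` placed in row `ℓ`. -/
def shiftedRow (A : Pattern) (k ℓ : ℕ) : Pattern :=
  fun p r => if r = ℓ then A p k else if r ≤ k then 0 else A p r

theorem shiftedRow_self (A : Pattern) (k : ℕ) : shiftedRow A k k = truncRows A k := by
  funext p r
  unfold shiftedRow truncRows
  split_ifs <;> first | rfl | (exfalso; omega) | (subst r; rfl)

theorem shiftedRow_eq_truncRows (A : Pattern) {k ℓ p r : ℕ} (h : r ≠ ℓ) :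
    shiftedRow A k ℓ p r = truncRows A (k + 1) p r := by
  unfold shiftedRow truncRows
  split_ifs <;> first | rfl | omega

theorem shiftedRow_apply_self (A : Pattern) (k ℓ p : ℕ) : shiftedRow A k ℓ p ℓ = A p k := if_pos rfl

section Runs

variable {n i m k : ℕ} {A : Pattern}

theorem truncRows_mem (hi : 1 ≤ i) (hin : i ≤ n) (hA : A ∈ polytope n i m) :
    truncRows A k ∈ (polytopeCrystal n i m).carrier := by
  rw [mem_carrier_iff hi hin]
  rw [polytope_eq_boxPolytope hi hin] at hA
  refine ⟨fun p q h => ?_, hA.2.mono fun p q => ?_⟩ <;> unfold truncRows <;> split_ifs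
  · rfl
  · exact hA.1 p q h
  · exact Nat.zero_le _
  · exact le_rfl

theorem fTop_shiftedRow {ℓ : ℕ} (hi : 1 ≤ i) (hiℓ : i ≤ ℓ) (hℓk : ℓ + 1 ≤ k) (hkn : k ≤ n)
    (hA : ∀ p q, ¬ (1 ≤ p ∧ p ≤ i ∧ i ≤ q ∧ q ≤ n) → A p q = 0)
    (hmem : shiftedRow A k (ℓ + 1) ∈ (polytopeCrystal n i m).carrier) :
    shiftedRow A k ℓ ∈ (polytopeCrystal n i m).carrier ∧
      (polytopeCrystal n i m).fTop (ℓ + 1) 0 (shiftedRow A k ℓ)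
        = some (shiftedRow A k (ℓ + 1)) := by
  have hin : i ≤ n := by omega
  have hsn := polytopeCrystal_isSeminormalAt (ℓ := ℓ + 1) (m := m) hi hin (by omega) (by omega)
  set P := shiftedRow A k (ℓ + 1) with hP
  have hu : ∀ j, transpose P ℓ j = 0 := fun j => by
    simp only [transpose, hP, shiftedRow]
    rw [if_neg (by omega), if_pos (by omega)]
  have hphi : (polytopeCrystal n i m).phi (ℓ + 1) P = 0 := by
    change polyPhi n i m (ℓ + 1) P = 0
    rw [polyPhi_of_gt hi hiℓ, pathMax_zero_left hi fun j _ _ => hu j, Nat.sub_self]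
  obtain ⟨y, hy⟩ := hsn.e_string.exists_opPow hmem le_rfl
  obtain ⟨hymem, hyeps⟩ := hsn.e_string.opPow_spec hmem hy
  have hyeps : polyEps n i m (ℓ + 1) y = 0 := by
    change (polytopeCrystal n i m).eps (ℓ + 1) y = 0
    omega
  have hfy := hsn.opPow_f_of_opPow_e hmem hy
  -- It remains to identify the end `y` of the `e`-string of the right hand side.
  suffices hyA : y = shiftedRow A k ℓ by
    rw [← hyA]
    exact ⟨hymem, hsn.fTop_zero_eq_some hymem hfy hphi⟩
  have hT : ∀ B ∈ (polytopeCrystal n i m).carrier, colDown 1 i ℓ (transpose B)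
      = ((polytopeCrystal n i m).e (ℓ + 1) B).map transpose := fun B _ => by
    change _ = (polyE n i m (ℓ + 1) B).map transpose
    rw [polyE_of_gt hi hiℓ, Option.map_map]
    exact (congrFun Option.map_id _).symm
  have hdown := hsn.e_string.opPow_map hT hmem ((polytopeCrystal n i m).eps (ℓ + 1) P)
  rw [hy, Option.map_some] at hdown
  obtain ⟨h1, h2, h3⟩ := opPow_colDown_spec hi hdown
  rw [polyEps_of_gt hi hiℓ] at hyeps
  have h4 := sum_le_pathMax_left (transpose y ℓ) (transpose y (ℓ + 1)) hi
  have h5 : ∀ r, 1 ≤ r → r ≤ i → transpose y ℓ r = transpose P (ℓ + 1) r := fun r hr hri =>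
    eq_of_tail_sums_eq (fun r hr hri => by
      rw [← pathMax_tail_eq_sum (w := transpose y (ℓ + 1)) hr hri (by omega), h1 r hr,
        pathMax_zero_left hri fun j _ _ => hu j]) hr hri
  have hPk : ∀ p, P p (ℓ + 1) = A p k := fun p => if_pos rfl
  have hy0 := ((mem_carrier_iff hi hin).mp hymem).1
  have hyℓ : ∀ p, y p ℓ = A p k := by
    intro p
    by_cases hp : 1 ≤ p ∧ p ≤ i
    · rw [← hPk]; exact h5 p hp.1 hp.2
    · rw [hy0 p ℓ (by tauto), hA p k (by tauto)]
  funext p q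
  rcases eq_or_ne q ℓ with rfl | hq
  · rw [hyℓ, shiftedRow, if_pos rfl]
  rcases eq_or_ne q (ℓ + 1) with rfl | hq'
  · have h6 := h2 p
    rw [hu] at h6
    change y p ℓ + y p (ℓ + 1) = 0 + P p (ℓ + 1) at h6
    rw [hyℓ, hPk] at h6
    rw [shiftedRow, if_neg hq, if_pos hℓk]
    omega
  · have h7 : y p q = P p q := congrFun (h3 q hq hq') p
    rw [h7, hP, shiftedRow_eq_truncRows A hq', shiftedRow_eq_truncRows A hq]

theorem shiftedRow_mem {ℓ : ℕ} (hi : 1 ≤ i) (hiℓ : i ≤ ℓ) (hℓk : ℓ ≤ k) (hkn : k ≤ n)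
    (hA : A ∈ polytope n i m) : shiftedRow A k ℓ ∈ (polytopeCrystal n i m).carrier := by
  induction hℓk using Nat.decreasingInduction with
  | self => rw [shiftedRow_self]; exact truncRows_mem hi (by omega) hA
  | of_succ ℓ hℓ ih => exact (fTop_shiftedRow hi hiℓ hℓ hkn hA.1 (ih (by omega))).1

/-! ### The two runs through the columns -/

/-- The relation between the states `P` and `R` reached by applying the maximal powers of
`f_i, …, f_{s+1}` to the rows of `A` above row `k`, without and with row `k` of `A` placed in
row `i`: the columns up to `s` have not been touched, and `R` has lost `∑_{j ≤ s} a_{j,k}` in the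
entry in row `i` of column `s + 1`. The paths along row `i` and up column `s + 1` have sum `m`. -/
structure RunInvariant (n i m k : ℕ) (A : Pattern) (s : ℕ) (P R : Pattern) : Prop where
  left_fst : ∀ j ≤ s, P j = truncRows A (k + 1) j
  left_snd : ∀ j ≤ s, R j = shiftedRow A k i j
  next_of_ne : s < i → ∀ r, r ≠ i → R (s + 1) r = P (s + 1) r
  next_self : s < i → R (s + 1) i + ∑ j ∈ Finset.Icc 1 s, A j k = P (s + 1) i
  right : ∀ j, s + 1 < j ∨ i < j → R j = P j
  sum_fst : s < i → ∑ r ∈ Finset.Icc i n, P (s + 1) r = m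
  sum_snd : s < i → ∑ r ∈ Finset.Icc i n, R (s + 1) r + ∑ j ∈ Finset.Icc 1 s, A j k = m

theorem RunInvariant.pathMax_fst {s : ℕ} {P R : Pattern} (h : RunInvariant n i m k A s P R)
    (hsi : s < i) (hin : i ≤ n) (hP : P ∈ boxPolytope 1 i i n m) :
    pathMax i n (P s) (P (s + 1)) = m := by
  refine le_antisymm (Finset.sup_le fun p hp => ?_) ?_
  · obtain ⟨h1, h2⟩ := Finset.mem_Icc.mp hp
    have := row_add_pathSum_le hP hsi h1 h2
    omega
  · rw [← h.sum_fst hsi]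
    exact sum_le_pathMax_right _ _ hin

theorem RunInvariant.pathMax_snd {s : ℕ} {P R : Pattern} (h : RunInvariant n i m k A (s + 1) P R)
    (hsi : s + 1 < i) (hin : i ≤ n) (hR : R ∈ boxPolytope 1 i i n m) :
    pathMax i n (R (s + 1)) (R (s + 2)) + ∑ j ∈ Finset.Icc 1 s, A j k = m ∧
      pathMax i n (R (s + 1)) (R (s + 2)) = pathSum i n (R (s + 1)) (R (s + 2)) i := by
  have hle : ∀ p, i ≤ p → p ≤ n →
      ∑ j ∈ Finset.Icc 1 s, A j k + pathSum i n (R (s + 1)) (R (s + 2)) p ≤ m := by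
    intro p h1 h2
    have h3 := row_add_pathSum_le hR (s := s + 1) hsi h1 h2
    have h4 : ∑ j ∈ Finset.Icc 1 (s + 1 - 1), R j i = ∑ j ∈ Finset.Icc 1 s, A j k :=
      Finset.sum_congr rfl fun j hj => by
        rw [h.left_snd j (by have := Finset.mem_Icc.mp hj; omega), shiftedRow_apply_self]
    rwa [h4] at h3
  have hfirst : ∑ j ∈ Finset.Icc 1 s, A j k + pathSum i n (R (s + 1)) (R (s + 2)) i = m := by
    have h5 := h.sum_snd hsi
    rw [sum_Icc_add_one _ (by omega)] at h5
    rw [pathSum, Finset.Icc_self, Finset.sum_singleton, h.left_snd (s + 1) le_rfl,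
      shiftedRow_apply_self]
    rw [show s + 1 + 1 = s + 2 from rfl] at h5
    omega
  have hmax := pathMax_eq (u := R (s + 1)) (w := R (s + 2)) le_rfl hin fun q h1 h2 => by
    have := hle q h1 h2
    omega
  exact ⟨by omega, hmax⟩

theorem RunInvariant.init (hA : A ∈ polytope n i m) :
    RunInvariant n i m k A i (truncRows A (k + 1)) (shiftedRow A k i) where
  left_fst _ _ := rfl
  left_snd _ _ := rfl
  next_of_ne h := absurd h (lt_irrefl i)
  next_self h := absurd h (lt_irrefl i)
  right j hj := by
    funext r
    have h0 : ∀ q, A j q = 0 := fun q => hA.1 j q (by omega)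
    simp [shiftedRow, truncRows, h0]
  sum_fst h := absurd h (lt_irrefl i)
  sum_snd h := absurd h (lt_irrefl i)

/-- The first step of the runs: `f_i` fills the corner `(i, i)`. -/
theorem RunInvariant.corner_step {s : ℕ} (hs : s + 1 = i) (hin : i ≤ n) (hik : i ≤ k)
    {P R P' R' : Pattern} (h : RunInvariant n i m k A i P R)
    (hP : P ∈ (polytopeCrystal n i m).carrier) (hR : R ∈ (polytopeCrystal n i m).carrier)
    (hPP' : (polytopeCrystal n i m).fTop i 0 P = some P')
    (hRR' : (polytopeCrystal n i m).fTop i 0 R = some R') :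
    RunInvariant n i m k A s P' R' := by
  have hi : 1 ≤ i := by omega
  have hsn := polytopeCrystal_isSeminormalAt (m := m) hi hin hi hin
  obtain ⟨p1, p2⟩ := opPow_polyF_self hi (hsn.fTop_zero_spec hP hPP').1
  obtain ⟨r1, r2⟩ := opPow_polyF_self hi (hsn.fTop_zero_spec hR hRR').1
  change P' i i = P i i + polyPhi n i m i P at p1
  change R' i i = R i i + polyPhi n i m i R at r1
  rw [polyPhi_self hi, sum_Icc_eq_head_add _ hin] at p1 r1
  have p3 := row_add_col_le ((mem_carrier_iff hi hin).mp hP) hi hin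
  have r3 := row_add_col_le ((mem_carrier_iff hi hin).mp hR) hi hin
  rw [sum_Icc_eq_head_add _ hin] at p3 r3
  have p4 : ∑ j ∈ Finset.Icc 1 (i - 1), P j i = 0 := Finset.sum_eq_zero fun j hj => by
    rw [h.left_fst j (by have := Finset.mem_Icc.mp hj; omega), truncRows, if_pos (by omega)]
  have r4 : ∑ j ∈ Finset.Icc 1 (i - 1), R j i = ∑ j ∈ Finset.Icc 1 s, A j k := by
    rw [show i - 1 = s by omega]
    exact Finset.sum_congr rfl fun j hj => by
      rw [h.left_snd j (by have := Finset.mem_Icc.mp hj; omega), shiftedRow_apply_self]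
  have hne : ∀ r, r ≠ i → R i r = P i r := fun r hr => by
    rw [h.left_fst i le_rfl, h.left_snd i le_rfl, shiftedRow_eq_truncRows A hr]
  have hrest : ∑ r ∈ Finset.Icc (i + 1) n, R i r = ∑ r ∈ Finset.Icc (i + 1) n, P i r :=
    Finset.sum_congr rfl fun r hr => hne r (by have := Finset.mem_Icc.mp hr; omega)
  have hrestP : ∑ r ∈ Finset.Icc (i + 1) n, P' i r = ∑ r ∈ Finset.Icc (i + 1) n, P i r :=
    Finset.sum_congr rfl fun r hr => p2 i r (by have := Finset.mem_Icc.mp hr; omega)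
  have hrestR : ∑ r ∈ Finset.Icc (i + 1) n, R' i r = ∑ r ∈ Finset.Icc (i + 1) n, R i r :=
    Finset.sum_congr rfl fun r hr => r2 i r (by have := Finset.mem_Icc.mp hr; omega)
  refine ⟨fun j hj => ?_, fun j hj => ?_, fun _ r hr => ?_, fun _ => ?_, fun j hj => ?_,
    fun _ => ?_, fun _ => ?_⟩
  · rw [← h.left_fst j (by omega)]; funext r; exact p2 j r (by omega)
  · rw [← h.left_snd j (by omega)]; funext r; exact r2 j r (by omega)
  · rw [hs, p2 i r (by omega), r2 i r (by omega), hne r hr]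
  · rw [hs]; omega
  · funext r
    rw [p2 j r (by omega), r2 j r (by omega), h.right j (by omega)]
  · rw [hs, sum_Icc_eq_head_add _ hin]; omega
  · rw [hs, sum_Icc_eq_head_add _ hin]; omega

/-- A step of the runs with `f_{s+1}`, where `s + 1 < i`. -/
theorem RunInvariant.step {s : ℕ} (hsi : s + 1 < i) (hin : i ≤ n) (hik : i ≤ k)
    {P R P' R' : Pattern} (h : RunInvariant n i m k A (s + 1) P R)
    (hP : P ∈ (polytopeCrystal n i m).carrier) (hR : R ∈ (polytopeCrystal n i m).carrier)
    (hPP' : (polytopeCrystal n i m).fTop (s + 1) 0 P = some P')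
    (hRR' : (polytopeCrystal n i m).fTop (s + 1) 0 R = some R') :
    RunInvariant n i m k A s P' R' := by
  have hi : 1 ≤ i := by omega
  have hsn := polytopeCrystal_isSeminormalAt (ℓ := s + 1) (m := m) hi hin (by omega) (by omega)
  have hP' := ((mem_carrier_iff hi hin).mp (hsn.fTop_zero_spec hP hPP').2.1).1
  have hR' := ((mem_carrier_iff hi hin).mp (hsn.fTop_zero_spec hR hRR').2.1).1
  obtain ⟨p1, p2, p3⟩ := fTop_zero_spec_of_lt (by omega) hsi hin hP hPP'
  obtain ⟨r1, r2, r3⟩ := fTop_zero_spec_of_lt (by omega) hsi hin hR hRR'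
  have hmaxP := h.pathMax_fst hsi hin ((mem_carrier_iff hi hin).mp hP)
  have hmaxR := (h.pathMax_snd hsi hin ((mem_carrier_iff hi hin).mp hR)).1
  have hnextne := h.next_of_ne hsi
  have hcol : ∀ r, r ≠ i → R (s + 1) r = P (s + 1) r := fun r hr => by
    rw [h.left_fst _ le_rfl, h.left_snd _ le_rfl, shiftedRow_eq_truncRows A hr]
  have htail : ∀ r, i + 1 ≤ r → r ≤ n →
      ∑ j ∈ Finset.Icc r n, R' (s + 1) j = ∑ j ∈ Finset.Icc r n, P' (s + 1) j := fun r hr hrn => by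
    rw [p1 r (by omega) hrn, r1 r (by omega) hrn]
    exact pathMax_congr (fun j hj _ => hcol j (by omega)) fun j hj _ => hnextne j (by omega)
  have hne : ∀ r, r ≠ i → R' (s + 1) r = P' (s + 1) r := fun r hr => by
    by_cases hr' : i + 1 ≤ r ∧ r ≤ n
    · exact eq_of_tail_sums_eq htail hr'.1 hr'.2
    · rw [hP' (s + 1) r (by omega), hR' (s + 1) r (by omega)]
  have htail' : ∑ j ∈ Finset.Icc (i + 1) n, R' (s + 1) j
      = ∑ j ∈ Finset.Icc (i + 1) n, P' (s + 1) j :=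
    Finset.sum_congr rfl fun r hr => hne r (by have := Finset.mem_Icc.mp hr; omega)
  have hsumP : ∑ j ∈ Finset.Icc i n, P' (s + 1) j = m := by rw [p1 i le_rfl hin, hmaxP]
  have hsumR : ∑ j ∈ Finset.Icc i n, R' (s + 1) j + ∑ j ∈ Finset.Icc 1 s, A j k = m := by
    rw [r1 i le_rfl hin]; exact hmaxR
  have hself : R' (s + 1) i + ∑ j ∈ Finset.Icc 1 s, A j k = P' (s + 1) i := by
    rw [sum_Icc_eq_head_add _ hin] at hsumP hsumR
    omega
  refine ⟨fun j hj => ?_, fun j hj => ?_, fun _ => hne, fun _ => hself, fun j hj => ?_,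
    fun _ => hsumP, fun _ => hsumR⟩
  · rw [p3 j (by omega) (by omega), h.left_fst j (by omega)]
  · rw [r3 j (by omega) (by omega), h.left_snd j (by omega)]
  · rcases (show s + 2 ≤ j by omega).eq_or_lt with rfl | hj
    · funext r
      change R' (s + 1 + 1) r = P' (s + 1 + 1) r
      have h1 := p2 r
      have h2 := r2 r
      rcases eq_or_ne r i with rfl | hr
      · have h3 := h.next_self hsi
        rw [sum_Icc_add_one _ (by omega)] at h3
        have h4 : P (s + 1) r = 0 := by
          rw [h.left_fst _ le_rfl, truncRows, if_pos (by omega)]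
        have h5 : R (s + 1) r = A (s + 1) k := by
          rw [h.left_snd _ le_rfl, shiftedRow_apply_self]
        omega
      · have h3 := hne r hr
        have h4 := hcol r hr
        have h5 := hnextne r hr
        omega
    · rw [p3 j (by omega) (by omega), r3 j (by omega) (by omega), h.right j (by omega)]

theorem RunInvariant.eps_snd {s : ℕ} {P R : Pattern} (h : RunInvariant n i m k A (s + 1) P R)
    (hsi : s + 1 ≤ i) (hin : i ≤ n) (hR : R ∈ (polytopeCrystal n i m).carrier) :
    (polytopeCrystal n i m).eps (s + 1) R = A (s + 1) k := by
  have hi : 1 ≤ i := by omega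
  change polyEps n i m (s + 1) R = A (s + 1) k
  rcases hsi.eq_or_lt with rfl | hsi
  · rw [polyEps_self hi, h.left_snd _ le_rfl, shiftedRow_apply_self]
  · have h1 := (h.pathMax_snd hsi hin ((mem_carrier_iff hi hin).mp hR)).1
    have h2 := h.sum_snd hsi
    rw [sum_Icc_add_one _ (by omega)] at h2
    rw [polyEps_of_lt (by omega) hsi hin, show s + 1 + 1 = s + 2 from rfl]
    rw [show s + 1 + 1 = s + 2 from rfl] at h2
    omega

/-- If the entries of row `k` of `A` vanish to the left of column `t = s + 1`, then `P` and `R` lie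
on the same `t`-string. -/
theorem RunInvariant.opPow_f {s : ℕ} {P R : Pattern} (h : RunInvariant n i m k A (s + 1) P R)
    (hsi : s + 1 ≤ i) (hin : i ≤ n) (hik : i ≤ k)
    (hR : R ∈ (polytopeCrystal n i m).carrier) (hA : ∀ j ≤ s, A j k = 0) :
    opPow ((polytopeCrystal n i m).f (s + 1)) (A (s + 1) k) P = some R := by
  have hi : 1 ≤ i := by omega
  have hsn := polytopeCrystal_isSeminormalAt (ℓ := s + 1) (m := m) hi hin (by omega) (by omega)
  have heps := h.eps_snd hsi hin hR
  obtain ⟨y, hy⟩ := hsn.e_string.exists_opPow hR heps.ge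
  have hf := hsn.opPow_f_of_opPow_e hR hy
  suffices y = P by rwa [this] at hf
  have hleft : ∀ j ≤ s + 1, ∀ r, (j = s + 1 → r ≠ i) → R j r = P j r := by
    intro j hj r hr
    rw [h.left_fst j hj, h.left_snd j hj]
    rcases eq_or_ne r i with rfl | hri
    · rw [shiftedRow_apply_self, hA j (by omega), truncRows, if_pos (by omega)]
    · exact shiftedRow_eq_truncRows A hri
  have hself : P (s + 1) i = 0 := by rw [h.left_fst _ le_rfl, truncRows, if_pos (by omega)]
  rcases hsi.eq_or_lt with rfl | hsi
  · obtain ⟨h1, h2⟩ := opPow_polyF_self hi hf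
    rw [h.left_snd _ le_rfl, shiftedRow_apply_self] at h1
    funext j r
    by_cases hjr : j = s + 1 ∧ r = s + 1
    · rw [hjr.1, hjr.2, hself]; omega
    · rw [← h2 j r hjr]
      rcases le_or_gt j (s + 1) with hj | hj
      · exact hleft j hj r fun h' h'' => hjr ⟨h', h''⟩
      · rw [h.right j (Or.inr hj)]
  · have he : (polytopeCrystal n i m).e (s + 1) = colUp i n (s + 1) :=
      funext fun A => polyE_of_lt (by omega) hsi hin
    rw [he] at hy
    obtain ⟨h1, h2, h3, -⟩ := opPow_colUp_of_first hin
      (h.pathMax_snd hsi hin ((mem_carrier_iff hi hin).mp hR)).2 hy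
    have h4 := h.next_self hsi
    rw [sum_Icc_add_one _ (by omega), Finset.sum_eq_zero fun j hj =>
      hA j (Finset.mem_Icc.mp hj).2, zero_add] at h4
    have h5 : R (s + 1) i = A (s + 1) k := by rw [h.left_snd _ le_rfl, shiftedRow_apply_self]
    funext j r
    rcases lt_trichotomy j (s + 1) with hj | rfl | hj
    · rw [h3 j r (by omega), hleft j hj.le r (by omega)]
    · rcases eq_or_ne r i with rfl | hr
      · rw [hself]; omega
      · rw [h3 _ r (by omega), hleft _ le_rfl r fun _ => hr]
    · rcases (Nat.succ_le_of_lt hj).eq_or_lt with rfl | hj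
      · rcases eq_or_ne r i with rfl | hr
        · rw [← h4]; exact h2
        · rw [h3 _ r (by omega), h.next_of_ne hsi r hr]
      · rw [h3 j r (by omega), h.right j (Or.inl hj)]

/-- The states passed by the operators `F` and `E`. The first run `P` applies maximal powers of
`f_i, …, f_1` to the rows of `A` above row `k`, the second run `R` does so with row `k` of `A`
placed in row `i`; `F` follows the first run down to column `t` and changes to the
second one, which `E` follows backwards. -/
theorem exists_runs (hi : 1 ≤ i) (hik : i ≤ k) (hkn : k ≤ n) (hA : A ∈ polytope n i m) :
    ∃ P R : ℕ → Pattern, P i = truncRows A (k + 1) ∧ R i = shiftedRow A k i ∧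
      (∀ s ≤ i, P s ∈ (polytopeCrystal n i m).carrier) ∧
      (∀ s ≤ i, R s ∈ (polytopeCrystal n i m).carrier) ∧
      (∀ s < i, (polytopeCrystal n i m).fTop (s + 1) 0 (P (s + 1)) = some (P s)) ∧
      (∀ s < i, (polytopeCrystal n i m).eTop (s + 1) (A (s + 1) k) (R s) = some (R (s + 1))) ∧
      ∀ s < i, (∀ j ≤ s, A j k = 0) →
        opPow ((polytopeCrystal n i m).f (s + 1)) (A (s + 1) k) (P (s + 1))
          = some (R (s + 1)) := by
  have hin : i ≤ n := hik.trans hkn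
  have hsn : ∀ ℓ, 1 ≤ ℓ → ℓ ≤ i → (polytopeCrystal n i m).IsSeminormalAt ℓ := fun ℓ h h' =>
    polytopeCrystal_isSeminormalAt hi hin h (h'.trans hin)
  obtain ⟨P, p1, p2, p3⟩ := exists_maximal_run hsn (truncRows_mem (k := k + 1) hi hin hA)
  obtain ⟨R, r1, r2, r3⟩ := exists_maximal_run hsn (shiftedRow_mem hi le_rfl hik hkn hA)
  have hinv : ∀ s ≤ i, RunInvariant n i m k A s (P s) (R s) := by
    intro s hs
    induction hs using Nat.decreasingInduction with
    | self => rw [p1, r1]; exact .init hA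
    | of_succ s hs ih =>
      rcases (Nat.succ_le_of_lt hs).eq_or_lt with h | h
      · rw [Nat.succ_eq_add_one] at h
        subst h
        exact ih.corner_step rfl hin hik (p2 _ le_rfl) (r2 _ le_rfl) (p3 _ hs) (r3 _ hs)
      · exact ih.step h hin hik (p2 _ hs) (r2 _ hs) (p3 s hs) (r3 s hs)
  refine ⟨P, R, p1, r1, p2, r2, p3, fun s hs => ?_, fun s hs hA' => ?_⟩
  · rw [← (hinv (s + 1) hs).eps_snd hs hin (r2 _ hs)]
    exact (hsn (s + 1) (by omega) hs).eTop_of_fTop_zero (r2 _ hs) (r3 s hs)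
  · exact (hinv (s + 1) hs).opPow_f hs hin hik (r2 _ hs) hA'

end Runs

/-! ### The highest weight tableau -/

theorem foldl_bracketStep_eq_self {T : Filling} {j : ℕ} {L : List (ℕ × ℕ)}
    (hL : ∀ b ∈ L, T b.1 b.2 ≠ j ∧ T b.1 b.2 ≠ j + 1) (s : List (ℕ × ℕ) × List (ℕ × ℕ)) :
    L.foldl (bracketStep T j) s = s := by
  induction L generalizing s with
  | nil => rfl
  | cons b L ih =>
    have hb := hL b List.mem_cons_self
    rw [List.foldl_cons, bracketStep, if_neg hb.2, if_neg hb.1]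
    exact ih (fun b' hb' => hL b' (List.mem_cons_of_mem b hb')) s

/-- The box at the end of row `r` is unpaired if it contains `j + 1` and if the rows above it
contain neither `j` nor `j + 1`. -/
theorem sigE_ne_none {i m j r : ℕ} {T : Filling} (hr : r < i) (hT : T r m = j + 1)
    (habove : ∀ r' < r, ∀ c ≤ m, T r' c ≠ j ∧ T r' c ≠ j + 1) : sigE i (m + 1) j T ≠ none := by
  obtain ⟨d, rfl⟩ : ∃ d, i = r + 1 + d := ⟨i - (r + 1), by omega⟩
  obtain ⟨L, hL⟩ : ∃ L, readingOrder (r + 1 + d) (m + 1) = L ++ (r, m) ::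
      (List.range r).reverse.flatMap (fun r => (List.range (m + 1)).map (fun c => (r, c))) := by
    have h1 : (List.range (r + 1 + d)).reverse
        = ((List.range d).map (r + 1 + ·)).reverse ++ r :: (List.range r).reverse := by
      rw [List.range_add, List.reverse_append, List.range_succ, List.reverse_append,
        List.reverse_singleton, List.singleton_append]
    have h2 : (List.range (m + 1)).map (fun c => (r, c))
        = (List.range m).map (fun c => (r, c)) ++ [(r, m)] := by
      rw [List.range_succ, List.map_append, List.map_singleton]
    rw [readingOrder, h1, List.flatMap_append, List.flatMap_cons, h2]
    exact ⟨_, by rw [List.append_assoc, List.singleton_append, ← List.append_assoc]⟩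
  have hrest : ∀ b ∈ (List.range r).reverse.flatMap
      (fun r => (List.range (m + 1)).map (fun c => (r, c))),
      T b.1 b.2 ≠ j ∧ T b.1 b.2 ≠ j + 1 := by
    intro b hb
    simp only [List.mem_flatMap, List.mem_reverse, List.mem_range, List.mem_map] at hb
    obtain ⟨r', hr', c, hc, rfl⟩ := hb
    exact habove r' hr' c (by omega)
  rw [sigE, unpaired, hL, List.foldl_append, List.foldl_cons, foldl_bracketStep_eq_self hrest,
    bracketStep, if_pos hT]
  simp

/-- The only tableau on which `e_1, …, e_n` vanish is the one whose `j`-th row consists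
of `j`'s: the last box of the first row with a different entry would be unpaired. -/
theorem eq_highestTableau {n i m : ℕ} {T : Filling} (hT : T ∈ ssyt n i m)
    (he : ∀ j, 1 ≤ j → j ≤ n → sigE i m j T = none) : T = highestTableau i m := by
  obtain ⟨⟨S, hS⟩, hrange⟩ := hT
  have hmem : ∀ r c, (r, c) ∈ rect i m ↔ r < i ∧ c < m := fun r c => by
    rw [← YoungDiagram.mem_cells]; simp [rect]
  have key : ∀ r < i, ∀ c < m, T r c = r + 1 := by
    intro r
    induction r using Nat.strong_induction_on with
    | _ r ih =>
      intro hr c hc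
      have hlow : r + 1 ≤ T r c := by
        rcases Nat.eq_zero_or_pos r with rfl | hr0
        · exact (hrange 0 hr c hc).1
        · have h1 := S.col_strict (show r - 1 < r by omega) ((hmem r c).mpr ⟨hr, hc⟩)
          rw [hS, hS, ih (r - 1) (by omega) (by omega) c hc] at h1
          omega
      refine le_antisymm ?_ hlow
      by_contra hgt
      obtain ⟨m, rfl⟩ : ∃ m', m = m' + 1 := ⟨m - 1, by omega⟩
      have hlast : T r c ≤ T r m := by
        rcases (Nat.le_of_lt_succ hc).eq_or_lt with rfl | h
        · exact le_rfl
        · have := S.row_weak h ((hmem r m).mpr ⟨hr, Nat.lt_succ_self m⟩)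
          rwa [hS, hS] at this
      have hn := (hrange r hr m (Nat.lt_succ_self m)).2
      refine sigE_ne_none (j := T r m - 1) hr (by omega) (fun r' hr' c' hc' => ?_)
        (he _ (by omega) (by omega))
      rw [ih r' hr' (by omega) c' (by omega)]
      omega
  funext r c
  unfold highestTableau
  split_ifs with h
  · exact key r h.1 c h.2
  · rw [← hS]; exact S.zeros (fun h' => h ((hmem r c).mp h'))

theorem zero_mem_polytope (n i m : ℕ) : (fun _ _ => 0 : Pattern) ∈ polytope n i m :=
  ⟨fun _ _ _ => rfl, fun _ _ => by simp⟩

theorem polyE_zero {n i m ℓ : ℕ} (hi : 1 ≤ i) (hin : i ≤ n) (hℓ : 1 ≤ ℓ) (hℓn : ℓ ≤ n) :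
    polyE n i m ℓ (fun _ _ => 0) = none := by
  have h := (polytopeCrystal_isSeminormalAt (m := m) hi hin hℓ hℓn).e_string.none_iff
    _ (zero_mem_polytope n i m)
  refine h.mpr ?_
  change polyEps n i m ℓ _ = 0
  rcases lt_trichotomy ℓ i with hlt | rfl | hgt
  · rw [polyEps_of_lt hℓ hlt hin, pathMax_zero_left hin fun _ _ _ => rfl]
    simp
  · exact polyEps_self hℓ
  · obtain ⟨ℓ, rfl⟩ : ∃ ℓ', ℓ = ℓ' + 1 := ⟨ℓ - 1, by omega⟩
    have hzero : transpose (fun _ _ => 0) = fun _ _ => 0 := rfl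
    rw [polyEps_of_gt hi (by omega), hzero, pathMax_zero_left hi fun _ _ _ => rfl]
    simp

theorem map_zero_eq_highestTableau {n i m : ℕ} (hi : 1 ≤ i) (hin : i ≤ n)
    {Φ : Pattern → Filling}
    (hΦ : IsCrystalIso n (polytopeCrystal n i m) (tableauCrystal n i m) Φ) :
    Φ (fun _ _ => 0) = highestTableau i m := by
  have h0 := zero_mem_polytope n i m
  refine eq_highestTableau (hΦ.bijOn.mapsTo h0) fun j hj hjn => ?_
  have h := hΦ.map_e j hjn _ h0
  change tabE n i m j _ = (polyE n i m j _).map Φ at h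
  rwa [polyE_zero hi hin hj hjn, tabE, if_neg (by omega)] at h

/-! ### First rows and first columns -/

section FirstRow

variable {n i m k : ℕ} {A Q : Pattern}

theorem le_firstRow (hin : i ≤ n) : i ≤ firstRow n i Q := by
  unfold firstRow
  rcases Finset.eq_empty_or_nonempty ((Finset.Icc i n).filter (fun k => rowSupport i Q k ≠ ∅))
    with h | h
  · rw [h]; change i ≤ n + 1; omega
  · rw [minOr_eq h]
    exact (Finset.mem_Icc.mp (Finset.mem_filter.mp (Finset.min'_mem _ h)).1).1

theorem firstRow_le : firstRow n i Q ≤ n + 1 := by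
  unfold firstRow
  rcases Finset.eq_empty_or_nonempty ((Finset.Icc i n).filter (fun k => rowSupport i Q k ≠ ∅))
    with h | h
  · rw [h]; exact le_rfl
  · rw [minOr_eq h]
    have := (Finset.mem_Icc.mp (Finset.mem_filter.mp (Finset.min'_mem _ h)).1).2
    omega

theorem rowSupport_eq_empty_of_lt {q : ℕ} (hiq : i ≤ q) (hqn : q ≤ n) (hq : q < firstRow n i Q) :
    rowSupport i Q q = ∅ := by
  by_contra hne
  have hmem : q ∈ (Finset.Icc i n).filter (fun k => rowSupport i Q k ≠ ∅) :=
    Finset.mem_filter.mpr ⟨Finset.mem_Icc.mpr ⟨hiq, hqn⟩, hne⟩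
  rw [firstRow, minOr_eq ⟨q, hmem⟩] at hq
  exact absurd (Finset.min'_le _ q hmem) (not_le.mpr hq)

theorem rowSupport_firstRow_nonempty (h : firstRow n i Q ≤ n) :
    (rowSupport i Q (firstRow n i Q)).Nonempty := by
  rcases Finset.eq_empty_or_nonempty ((Finset.Icc i n).filter (fun k => rowSupport i Q k ≠ ∅))
    with he | hne
  · rw [firstRow, he] at h
    exact absurd h (by change ¬ n + 1 ≤ n; omega)
  · have h1 := (Finset.mem_filter.mp (Finset.min'_mem _ hne)).2
    rw [← minOr_eq (d := n + 1) hne] at h1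
    exact Finset.nonempty_iff_ne_empty.mpr h1

theorem eq_zero_of_rowSupport_eq_empty {q : ℕ} (h : rowSupport i Q q = ∅)
    (hQ : ∀ p, ¬ (1 ≤ p ∧ p ≤ i) → Q p q = 0) (p : ℕ) : Q p q = 0 := by
  by_cases hp : 1 ≤ p ∧ p ≤ i
  · by_contra hne
    have : p ∈ rowSupport i Q q := Finset.mem_filter.mpr ⟨Finset.mem_Icc.mpr hp, hne⟩
    rw [h] at this
    exact absurd this (Finset.notMem_empty p)
  · exact hQ p hp

theorem eq_zero_of_lt_firstRow (hA : A ∈ polytope n i m) {p q : ℕ} (hq : q < firstRow n i A) :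
    A p q = 0 := by
  by_cases hq' : i ≤ q ∧ q ≤ n
  · exact eq_zero_of_rowSupport_eq_empty (rowSupport_eq_empty_of_lt hq'.1 hq'.2 hq)
      (fun p hp => hA.1 p q (by tauto)) p
  · exact hA.1 p q (by tauto)

theorem truncRows_firstRow (hA : A ∈ polytope n i m) : truncRows A (firstRow n i A) = A := by
  funext p q
  unfold truncRows
  split_ifs with h
  · exact (eq_zero_of_lt_firstRow hA h).symm
  · rfl

theorem truncRows_eq_zero (hA : A ∈ polytope n i m) : truncRows A (n + 1) = fun _ _ => 0 := by
  funext p q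
  unfold truncRows
  split_ifs with h
  · rfl
  · exact hA.1 p q (by omega)

theorem truncRows_succ_of_row_eq_zero (h : ∀ p, A p k = 0) :
    truncRows A (k + 1) = truncRows A k := by
  funext p q
  unfold truncRows
  split_ifs with h1 h2
  · rfl
  · rw [show q = k by omega, h]
  · omega
  · rfl

theorem rowSupport_truncRows_of_lt {q : ℕ} (h : q < k) : rowSupport i (truncRows A k) q = ∅ := by
  simp [rowSupport, truncRows, h]

theorem rowSupport_truncRows_self : rowSupport i (truncRows A k) k = rowSupport i A k := by
  simp [rowSupport, truncRows]

theorem truncRows_mem_polytope (hi : 1 ≤ i) (hin : i ≤ n) (hA : A ∈ polytope n i m) :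
    truncRows A k ∈ polytope n i m := truncRows_mem hi hin hA

theorem le_firstRow_truncRows (hkn : k ≤ n) : k ≤ firstRow n i (truncRows A k) := by
  by_contra hlt
  have h := rowSupport_firstRow_nonempty (Q := truncRows A k) (n := n) (i := i) (by omega)
  rw [rowSupport_truncRows_of_lt (by omega)] at h
  exact Finset.not_nonempty_empty h

theorem firstRow_truncRows (hik : i ≤ k) (hkn : k ≤ n) (h : rowSupport i A k ≠ ∅) :
    firstRow n i (truncRows A k) = k := by
  refine le_antisymm (not_lt.mp fun hlt => h ?_) (le_firstRow_truncRows hkn)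
  rw [← rowSupport_truncRows_self]
  exact rowSupport_eq_empty_of_lt hik hkn hlt

theorem firstCol_mem (h : firstRow n i Q ≤ n) :
    firstCol n i Q ∈ rowSupport i Q (firstRow n i Q) ∧
      ∀ p ∈ rowSupport i Q (firstRow n i Q), firstCol n i Q ≤ p := by
  have hne := rowSupport_firstRow_nonempty h
  rw [firstCol, minOr_eq hne]
  exact ⟨Finset.min'_mem _ hne, fun p hp => Finset.min'_le _ p hp⟩

/-- To the left of the column `t` used by `𝒦_k`, row `k` of `A` vanishes, whether or not it
is the first non-zero row of `A^{(k)}`. -/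
theorem eq_zero_of_lt_firstCol (hik : i ≤ k) (hkn : k ≤ n) (hA : A ∈ polytope n i m)
    (h : firstRow n i (truncRows A k) ≤ n) {p : ℕ} (hp : p < firstCol n i (truncRows A k)) :
    A p k = 0 := by
  have hsupp : ∀ p, ¬ (1 ≤ p ∧ p ≤ i) → A p k = 0 := fun p hp => hA.1 p k (by tauto)
  by_cases hrow : rowSupport i A k = ∅
  · exact eq_zero_of_rowSupport_eq_empty hrow hsupp p
  · by_contra hne
    have hmin := (firstCol_mem h).2
    rw [firstRow_truncRows hik hkn hrow, rowSupport_truncRows_self] at hmin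
    have hp1 : 1 ≤ p ∧ p ≤ i := by_contra fun h' => hne (hsupp p h')
    have := hmin p (Finset.mem_filter.mpr ⟨Finset.mem_Icc.mpr hp1, hne⟩)
    omega

end FirstRow

/-! ### The inductive operators on tableaux -/

section InductiveOperators

variable {n i m k : ℕ} {Φ : Pattern → Filling} {A : Pattern}

/-- The operator `𝒦_k` inserts row `k`: it maps the image of `A^{(k+1)}` to the image
of `A^{(k)}`. -/
theorem opK_truncRows (hi : 1 ≤ i) (hik : i ≤ k) (hkn : k ≤ n)
    (hΦ : IsCrystalIso n (polytopeCrystal n i m) (tableauCrystal n i m) Φ)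
    (hA : A ∈ polytope n i m) :
    opK (tableauCrystal n i m) n i (truncRows A k) k (Φ (truncRows A (k + 1)))
      = some (Φ (truncRows A k)) := by
  have hin : i ≤ n := hik.trans hkn
  unfold opK
  split_ifs with hzero
  · rw [truncRows_succ_of_row_eq_zero fun p => ?_]
    have h := eq_zero_of_lt_firstRow (truncRows_mem_polytope (k := k) hi hin hA)
      (p := p) (show k < firstRow n i (truncRows A k) by omega)
    simpa [truncRows] using h
  · have hfr : firstRow n i (truncRows A k) ≤ n := not_lt.mp hzero
    set t := firstCol n i (truncRows A k) with ht
    obtain ⟨ht1, hti⟩ := Finset.mem_Icc.mp (Finset.mem_filter.mp (firstCol_mem hfr).1).1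
    rw [← ht] at ht1 hti
    have hleft : ∀ j < t, A j k = 0 := fun j hj => eq_zero_of_lt_firstCol hik hkn hA hfr hj
    have hQ : ∀ p, truncRows A k p k = A p k := fun p => if_neg (lt_irrefl k)
    obtain ⟨P, R, p0, r0, hP, hR, hPP, hRR, hPR⟩ := exists_runs hi hik hkn hA
    have hsn : ∀ ℓ, 1 ≤ ℓ → ℓ ≤ n → (polytopeCrystal n i m).IsSeminormalAt ℓ := fun ℓ h h' =>
      polytopeCrystal_isSeminormalAt hi hin h h'
    -- `F` follows the run `P` from column `i` down to column `t`, and then changes to the run `R`.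
    have hF : opF (tableauCrystal n i m) i k t (truncRows A k) (Φ (truncRows A (k + 1)))
        = some (Φ (R t)) := by
      have h1 := opProd_eq_some_of_chain (s := t + 1) (t := i) (by omega)
        (g := fun j => (tableauCrystal n i m).fTop j 0) (fun j => Φ (P (j - 1))) (by
          intro j hj hji
          obtain ⟨s, rfl⟩ : ∃ s, j = s + 1 := ⟨j - 1, by omega⟩
          simp only [Nat.add_sub_cancel]
          rw [hΦ.fTop_map (by omega) (hsn _ (by omega) (by omega)) (fun _ => rfl) (hP _ hji),
            hPP s hji, Option.map_some])
      simp only [Nat.add_sub_cancel, p0] at h1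
      obtain ⟨s, hs⟩ : ∃ s, t = s + 1 := ⟨t - 1, by omega⟩
      rw [opF, h1, Option.bind_some, hQ, (hsn t ht1 (by omega)).f_string.opPow_map
        (hΦ.map_f t (by omega)) (hP t hti), hs, hPR s (by omega) fun j hj => hleft j (by omega),
        Option.map_some]
    -- `E` follows the run `R` backwards.
    have hE : opE (tableauCrystal n i m) i k t (truncRows A k) (Φ (R t)) = some (Φ (R i)) := by
      have h1 := opProd_eq_some_of_chain (s := t + 1) (t := i) (by omega)
        (g := fun j => (tableauCrystal n i m).eTop (i + t + 1 - j)
          (truncRows A k (i + t + 1 - j) k)) (fun j => Φ (R (i + t + 1 - j))) (by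
          intro j hj hji
          obtain ⟨s, hs⟩ : ∃ s, i + t + 1 - j = s + 1 := ⟨i + t - j, by omega⟩
          rw [show i + t + 1 - (j + 1) = s by omega, hs, hQ,
            hΦ.eTop_map (by omega) (hsn _ (by omega) (by omega)) (fun _ => rfl) (hR _ (by omega)),
            hRR s (by omega), Option.map_some])
      rwa [show i + t + 1 - (i + 1) = t by omega, show i + t + 1 - (t + 1) = i by omega] at h1
    -- `H` moves the new row from row `i` to row `k`.
    have hH : opH (tableauCrystal n i m) i k (Φ (R i)) = some (Φ (truncRows A k)) := by
      have h1 := opProd_eq_some_of_chain (s := i + 1) (t := k) (by omega)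
        (g := fun j => (tableauCrystal n i m).fTop (k + i + 1 - j) 0)
        (fun j => Φ (shiftedRow A k (k + i + 1 - j))) (by
          intro j hj hjk
          obtain ⟨ℓ, hℓ⟩ : ∃ ℓ, k + i + 1 - j = ℓ + 1 := ⟨k + i - j, by omega⟩
          obtain ⟨h2, h3⟩ := fTop_shiftedRow (ℓ := ℓ) hi (by omega) (by omega) hkn hA.1
            (shiftedRow_mem (m := m) hi (by omega) (by omega) hkn hA)
          rw [show k + i + 1 - (j + 1) = ℓ by omega, hℓ,
            hΦ.fTop_map (by omega) (hsn _ (by omega) (by omega)) (fun _ => rfl) h2, h3,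
            Option.map_some])
      rwa [show k + i + 1 - (k + 1) = i by omega, show k + i + 1 - (i + 1) = k by omega,
        shiftedRow_self, ← r0] at h1
    rw [hF, Option.bind_some, hE, Option.bind_some, hH]

end InductiveOperators

end KR

theorem mainTheorem2 (n i m : ℕ) (hi : 1 ≤ i) (hin : i ≤ n) (hm : 1 ≤ m)
    (Φ : KR.Pattern → KR.Filling)
    (hΦ : KR.IsCrystalIso n (KR.polytopeCrystal n i m) (KR.tableauCrystal n i m) Φ)
    (A : KR.Pattern) (hA : A ∈ KR.polytope n i m) :
    KR.opProd (KR.firstRow n i A) n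
        (fun k => KR.opK (KR.tableauCrystal n i m) n i (KR.truncRows A k) k)
        (KR.highestTableau i m) = some (Φ A) ∧
    KR.opProd (KR.firstRow n i A) n
        (fun k T =>
          if KR.rowSupport i A k = ∅ then some T
          else
            KR.opK (KR.tableauCrystal n i m) n i (KR.truncRows A k)
              (KR.firstRow n i (KR.truncRows A k)) T)
        (KR.highestTableau i m) = some (Φ A) := by
  have hfirst := KR.le_firstRow (Q := A) hin
  have hstart : Φ (KR.truncRows A (n + 1)) = KR.highestTableau i m := by
    rw [KR.truncRows_eq_zero hA, KR.map_zero_eq_highestTableau hi hin hΦ]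
  have hend : Φ (KR.truncRows A (KR.firstRow n i A)) = Φ A := by rw [KR.truncRows_firstRow hA]
  rw [← hstart, ← hend]
  refine ⟨KR.opProd_eq_some_of_chain KR.firstRow_le (fun k => Φ (KR.truncRows A k))
      fun k hk hkn => KR.opK_truncRows hi (hfirst.trans hk) hkn hΦ hA,
    KR.opProd_eq_some_of_chain KR.firstRow_le (fun k => Φ (KR.truncRows A k))
      fun k hk hkn => ?_⟩
  have hik := hfirst.trans hk
  split_ifs with hrow
  · rw [KR.truncRows_succ_of_row_eq_zero
      (KR.eq_zero_of_rowSupport_eq_empty hrow fun p hp => hA.1 p k (by tauto))]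
  · rw [KR.firstRow_truncRows hik hkn hrow]
    exact KR.opK_truncRows hi hik hkn hΦ hA
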